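/- Fix a separable infinite-dimensional complex Hilbert space $L$; let $\mathcal B$ and $\mathcal K$ be the algebras of bounded and of compact operators on $L$, and fix a unitary isomorphism $\iota: L\to L\,\dot\otimes\,L$, where $\dot\otimes$ is the Hilbert tensor product (of Hilbert spaces and of bounded operators). For $a,b\in\mathcal B$ put $a\diamond b:=\iota^*(a\,\dot\otimes\,b)\iota$. For a complex linear space $E$ let $\mathcal K E:=\mathcal K\otimes E$ (algebraic tensor product), a $\mathcal B$-bimodule with $a\cdot(b\otimes x)=ab\otimes x$ and $(b\otimes x)\cdot a=ba\otimes x$. A quantum norm on $E$ is a norm on $\mathcal K E$ such that (i) $\|a\cdot u\|,\|u\cdot a\|\le\|a\|\,\|u\|$ for $a\in\mathcal B$, $u\in\mathcal K E$; (ii) $\|u+v\|=\max\{\|u\|,\|v\|\}$ whenever there are orthogonal projections $P,Q\in\mathcal B$ with $PQ=0$, $P\cdot u=u=u\cdot P$ and $Q\cdot v=v=v\cdot Q$. A quantum space is a linear space with a quantum norm. A linear map $\varphi:E\to F$ of quantum spaces is a complete isometric isomorphism if $\mathbf 1\otimes\varphi:\mathcal K E\to\mathcal K F$ is an isometric isomorphism.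 For a Hilbert space $H$ with complex-conjugate space $\overline H$, the column Hilbertian $H_c$ (respectively, the row Hilbertian $H_r$) is $H$ with the quantum norm in which the norm of $\sum_k a_k\otimes x_k\in\mathcal K H$ is the operator norm of $\sum_k a_k\,\dot\otimes\,I(x_k)$, where $I:H\to\mathcal B(\mathbb C,H)$, $I(x)(1)=x$ (respectively, $I:H\to\mathcal B(\overline H,\mathbb C)$, $I(x)(y)=\langle x,y\rangle$, the inner product being linear in $x$). For quantum spaces $E,F$ and $u\in\mathcal K E$, $v\in\mathcal K F$ let $u\odot v,\ u\diamond v\in\mathcal K(E\otimes F)$ be bilinear in $(u,v)$ with $(a\otimes x)\odot(b\otimes y)=ab\otimes(x\otimes y)$ and $(a\otimes x)\diamond(b\otimes y)=(a\diamond b)\otimes(x\otimes y)$. The Haagerup tensor product $E\otimes_h F$ and the four-named tensor product $E\otimes_4F$ are the algebraic tensor product $E\otimes F$ with, respectively, the quantum norms $$\|U\|_h=\inf\Big\{\sum_{k=1}^n\|u_k\|\,\|v_k\| : U=\sum_{k=1}^n u_k\odot v_k\Big\},$$ $$\|U\|_4=\inf\Big\{\sum_{k=1}^n\|a_k\|\,\|u_k\|\,\|v_k\|\,\|b_k\|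 : U=\sum_{k=1}^n a_k\cdot(u_k\diamond v_k)\cdot b_k\Big\},$$ for $U\in\mathcal K(E\otimes F)$, where $a_k,b_k\in\mathcal K$, $u_k\in\mathcal K E$, $v_k\in\mathcal K F$. **Proposition.** For every quantum space $E$ and every Hilbert space $H$, the identity operators $E\otimes_4H_c\to E\otimes_hH_c$ and $H_r\otimes_4E\to H_r\otimes_hE$ are complete isometric isomorphisms. -/

import Mathlib

open scoped TensorProduct InnerProductSpace
open UniformSpace

noncomputable section

/-! ### Hilbert tensor products -/

/-- The Hilbert tensor product of two Hilbert spaces: the completion of the algebraic tensor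
product with respect to its canonical inner product. -/
def HilbertTensor (H K : Type*) [NormedAddCommGroup H] [InnerProductSpace ℂ H]
    [NormedAddCommGroup K] [InnerProductSpace ℂ K] : Type _ :=
  Completion (H ⊗[ℂ] K)

namespace HilbertTensor

variable (H K : Type*) [NormedAddCommGroup H] [InnerProductSpace ℂ H]
  [NormedAddCommGroup K] [InnerProductSpace ℂ K]

instance : NormedAddCommGroup (HilbertTensor H K) :=
  inferInstanceAs (NormedAddCommGroup (Completion (H ⊗[ℂ] K)))

instance : InnerProductSpace ℂ (HilbertTensor H K) :=
  inferInstanceAs (InnerProductSpace ℂ (Completion (H ⊗[ℂ] K)))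

instance : CompleteSpace (HilbertTensor H K) :=
  inferInstanceAs (CompleteSpace (Completion (H ⊗[ℂ] K)))

/-- The canonical isometric embedding of the algebraic tensor product into the Hilbert tensor
product. -/
def incl : H ⊗[ℂ] K →ₗᵢ[ℂ] HilbertTensor H K :=
  (Completion.toComplₗᵢ : H ⊗[ℂ] K →ₗᵢ[ℂ] Completion (H ⊗[ℂ] K))

variable {H K}

theorem induction_on {p : HilbertTensor H K → Prop} (x : HilbertTensor H K)
    (hp : IsClosed {x | p x}) (ih : ∀ z, p (incl H K z)) : p x :=
  Completion.induction_on (α := H ⊗[ℂ] K) x hp ih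

end HilbertTensor

open HilbertTensor (incl)

section HilbertTensorMap

variable {H₁ H₂ H₃ K₁ K₂ K₃ : Type*}
  [NormedAddCommGroup H₁] [InnerProductSpace ℂ H₁] [NormedAddCommGroup K₁] [InnerProductSpace ℂ K₁]
  [NormedAddCommGroup H₂] [InnerProductSpace ℂ H₂] [NormedAddCommGroup K₂] [InnerProductSpace ℂ K₂]
  [NormedAddCommGroup H₃] [InnerProductSpace ℂ H₃] [NormedAddCommGroup K₃] [InnerProductSpace ℂ K₃]

/-- The Hilbert tensor product of two bounded operators. -/
def hilbertMap (f : H₁ →L[ℂ] H₂) (g : K₁ →L[ℂ] K₂) : HilbertTensor H₁ K₁ →L[ℂ] HilbertTensor H₂ K₂ :=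
  (TensorProduct.mapL f g).completion

theorem hilbertMap_incl (f : H₁ →L[ℂ] H₂) (g : K₁ →L[ℂ] K₂) (z : H₁ ⊗[ℂ] K₁) :
    hilbertMap f g (incl H₁ K₁ z) = incl H₂ K₂ (TensorProduct.mapL f g z) :=
  ContinuousLinearMap.completion_apply_coe _ _

/-- Bounded operators on a Hilbert tensor product that agree on the algebraic tensor product
coincide. -/
theorem hilbert_ext {G : Type*} [NormedAddCommGroup G] [NormedSpace ℂ G]
    {S T : HilbertTensor H₁ K₁ →L[ℂ] G} (h : ∀ z, S (incl H₁ K₁ z) = T (incl H₁ K₁ z)) : S = T := by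
  ext x
  exact HilbertTensor.induction_on x (isClosed_eq S.continuous T.continuous) h

theorem hilbertMap_add_left (f f' : H₁ →L[ℂ] H₂) (g : K₁ →L[ℂ] K₂) :
    hilbertMap (f + f') g = hilbertMap f g + hilbertMap f' g :=
  hilbert_ext fun z => by
    simp only [add_apply, hilbertMap_incl, TensorProduct.mapL_add_left, map_add]

theorem hilbertMap_add_right (f : H₁ →L[ℂ] H₂) (g g' : K₁ →L[ℂ] K₂) :
    hilbertMap f (g + g') = hilbertMap f g + hilbertMap f g' :=
  hilbert_ext fun z => by
    simp only [add_apply, hilbertMap_incl, TensorProduct.mapL_add_right, map_add]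

theorem hilbertMap_smul_left (c : ℂ) (f : H₁ →L[ℂ] H₂) (g : K₁ →L[ℂ] K₂) :
    hilbertMap (c • f) g = c • hilbertMap f g :=
  hilbert_ext fun z => by
    simp only [smul_apply, hilbertMap_incl, TensorProduct.mapL_smul_left, map_smul]

theorem hilbertMap_smul_right (c : ℂ) (f : H₁ →L[ℂ] H₂) (g : K₁ →L[ℂ] K₂) :
    hilbertMap f (c • g) = c • hilbertMap f g :=
  hilbert_ext fun z => by
    simp only [smul_apply, hilbertMap_incl, TensorProduct.mapL_smul_right, map_smul]

theorem hilbertMap_comp (f' : H₂ →L[ℂ] H₃) (f : H₁ →L[ℂ] H₂) (g' : K₂ →L[ℂ] K₃)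
    (g : K₁ →L[ℂ] K₂) :
    hilbertMap (f' ∘L f) (g' ∘L g) = hilbertMap f' g' ∘L hilbertMap f g :=
  hilbert_ext fun z => by
    simp only [ContinuousLinearMap.comp_apply, hilbertMap_incl, TensorProduct.mapL_comp]

theorem norm_hilbertMap_le (f : H₁ →L[ℂ] H₂) (g : K₁ →L[ℂ] K₂) :
    ‖hilbertMap f g‖ ≤ ‖f‖ * ‖g‖ := by
  refine ContinuousLinearMap.opNorm_le_bound _ (by positivity) fun x => ?_
  refine HilbertTensor.induction_on (p := fun x => ‖hilbertMap f g x‖ ≤ ‖f‖ * ‖g‖ * ‖x‖) x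
    (isClosed_le (by fun_prop) (by fun_prop)) fun z => ?_
  rw [hilbertMap_incl, LinearIsometry.norm_map, LinearIsometry.norm_map]
  exact (ContinuousLinearMap.le_opNorm _ _).trans
    (mul_le_mul_of_nonneg_right (TensorProduct.norm_mapL_le f g) (norm_nonneg _))

/-- The Hilbert tensor product of bounded operators as a bilinear map. -/
def hilbertMapₗ : (H₁ →L[ℂ] H₂) →ₗ[ℂ] (K₁ →L[ℂ] K₂) →ₗ[ℂ]
    (HilbertTensor H₁ K₁ →L[ℂ] HilbertTensor H₂ K₂) :=
  LinearMap.mk₂ ℂ hilbertMap hilbertMap_add_left hilbertMap_smul_left hilbertMap_add_right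
    hilbertMap_smul_right

/-- The extension of a bounded operator from the algebraic to the Hilbert tensor product. -/
def fromHilbert {G : Type*} [NormedAddCommGroup G] [NormedSpace ℂ G] [CompleteSpace G]
    (S : H₁ ⊗[ℂ] K₁ →L[ℂ] G) : HilbertTensor H₁ K₁ →L[ℂ] G :=
  S.fromCompletion

theorem fromHilbert_incl {G : Type*} [NormedAddCommGroup G] [NormedSpace ℂ G] [CompleteSpace G]
    (S : H₁ ⊗[ℂ] K₁ →L[ℂ] G) (z : H₁ ⊗[ℂ] K₁) : fromHilbert S (incl H₁ K₁ z) = S z :=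
  ContinuousLinearMap.fromCompletion_apply_coe S z

theorem complete_of_finiteDimensional (X : Type*) [NormedAddCommGroup X] [InnerProductSpace ℂ X]
    [FiniteDimensional ℂ X] : CompleteSpace X := FiniteDimensional.complete ℂ X

/-- An operator that factors through a finite-dimensional space is compact. -/
theorem isCompactOperator_of_factor {X Y V : Type*} [NormedAddCommGroup X] [NormedSpace ℂ X]
    [NormedAddCommGroup Y] [NormedSpace ℂ Y] [NormedAddCommGroup V] [NormedSpace ℂ V]
    [FiniteDimensional ℂ V] (S : V →L[ℂ] Y) (T : X →L[ℂ] V) : IsCompactOperator (S ∘L T) := by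
  have h : IsCompactOperator (_root_.id : V → V) :=
    (isCompactOperator_id_iff_finiteDimensional (𝕜 := ℂ)).2 inferInstance
  exact (h.clm_comp S).comp_clm T

/-- A compact operator into a Hilbert space is nearly unchanged by some finite-dimensional
orthogonal projection. -/
theorem exists_projection_close [CompleteSpace H₂] {f : H₁ →L[ℂ] H₂} (hf : IsCompactOperator f)
    {ε : ℝ} (hε : 0 < ε) : ∃ V : Submodule ℂ H₂, ∃ _ : FiniteDimensional ℂ V,
      ‖f - V.subtypeL ∘L (V.orthogonalProjectionOnto ∘L f)‖ ≤ ε := by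
  have htb := (IsCompactOperator.isCompact_closure_image_closedBall
    (f := (f : H₁ →ₗ[ℂ] H₂)) hf 1).totallyBounded
  obtain ⟨t, ht, hcov⟩ := Metric.totallyBounded_iff.1 htb ε hε
  have hfin : FiniteDimensional ℂ (Submodule.span ℂ t) := FiniteDimensional.span_of_finite ℂ ht
  refine ⟨Submodule.span ℂ t, hfin, ?_⟩
  refine ContinuousLinearMap.opNorm_le_of_unit_norm (𝕜 := ℂ) hε.le fun x hx => ?_
  have hx' : f x ∈ closure ((f : H₁ →ₗ[ℂ] H₂) '' Metric.closedBall 0 1) :=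
    subset_closure ⟨x, by simp [hx], rfl⟩
  obtain ⟨y, hy, hxy⟩ := Set.mem_iUnion₂.1 (hcov hx')
  have hys : y ∈ Submodule.span ℂ t := Submodule.subset_span hy
  have hmin : ‖f x - (Submodule.span ℂ t).starProjection (f x)‖ ≤ ‖f x - y‖ := by
    rw [Submodule.starProjection_minimal]
    exact ciInf_le ⟨0, by rintro _ ⟨w, rfl⟩; exact norm_nonneg _⟩
      (⟨y, hys⟩ : Submodule.span ℂ t)
  have : ‖f x - y‖ < ε := by rwa [Metric.mem_ball, dist_eq_norm] at hxy
  exact hmin.trans this.le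

/-- The Hilbert tensor product of two compact operators is compact. -/
theorem hilbertMap_compact [CompleteSpace H₂] [CompleteSpace K₂] {f : H₁ →L[ℂ] H₂}
    {g : K₁ →L[ℂ] K₂} (hf : IsCompactOperator f) (hg : IsCompactOperator g) :
    IsCompactOperator (hilbertMap f g) := by
  have key : hilbertMap f g ∈ closure {T : HilbertTensor H₁ K₁ →L[ℂ] HilbertTensor H₂ K₂ |
      IsCompactOperator T} := by
    refine Metric.mem_closure_iff.2 fun ε hε => ?_
    set δ : ℝ := min 1 (ε / (‖f‖ + ‖g‖ + 2)) with hδdef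
    have hpos : 0 < ‖f‖ + ‖g‖ + 2 := by positivity
    have hδ : 0 < δ := lt_min one_pos (div_pos hε hpos)
    have hδ1 : δ ≤ 1 := min_le_left _ _
    have hδε : δ * (‖f‖ + ‖g‖ + 2) ≤ ε := by
      have := min_le_right 1 (ε / (‖f‖ + ‖g‖ + 2))
      rwa [← hδdef, le_div_iff₀ hpos] at this
    obtain ⟨V, hV, hfV⟩ := exists_projection_close hf hδ
    obtain ⟨W, hW, hgW⟩ := exists_projection_close hg hδ
    set f' : H₁ →L[ℂ] V := V.orthogonalProjectionOnto ∘L f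
    set g' : K₁ →L[ℂ] W := W.orthogonalProjectionOnto ∘L g
    have : CompleteSpace (V ⊗[ℂ] W) := complete_of_finiteDimensional _
    refine ⟨hilbertMap (V.subtypeL ∘L f') (W.subtypeL ∘L g'), ?_, ?_⟩
    · have hfac : hilbertMap (V.subtypeL ∘L f') (W.subtypeL ∘L g') =
          ((incl H₂ K₂).toContinuousLinearMap ∘L TensorProduct.mapL V.subtypeL W.subtypeL) ∘L
            fromHilbert (TensorProduct.mapL f' g') := by
        refine hilbert_ext fun z => ?_
        rw [hilbertMap_incl, TensorProduct.mapL_comp, ContinuousLinearMap.comp_apply,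
          ContinuousLinearMap.comp_apply, fromHilbert_incl]
        rfl
      rw [Set.mem_ofPred_eq, hfac]
      exact isCompactOperator_of_factor _ _
    · set a := V.subtypeL ∘L f'
      set b := W.subtypeL ∘L g'
      have hsplit : hilbertMap f g - hilbertMap a b =
          hilbertMap (f - a) g + hilbertMap a (g - b) := by
        have h1 := hilbertMap_add_left (f - a) a g
        have h2 := hilbertMap_add_right a (g - b) b
        rw [sub_add_cancel] at h1 h2
        rw [h1, h2]
        abel
      have ha : ‖a‖ ≤ ‖f‖ + 1 := by
        have : ‖a‖ ≤ ‖f‖ + ‖f - a‖ := by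
          have h := norm_sub_le f (f - a)
          rwa [sub_sub_cancel] at h
        linarith
      rw [dist_eq_norm, hsplit]
      have e1 : ‖hilbertMap (f - a) g‖ ≤ δ * ‖g‖ :=
        (norm_hilbertMap_le _ _).trans (mul_le_mul_of_nonneg_right hfV (norm_nonneg _))
      have e2 : ‖hilbertMap a (g - b)‖ ≤ (‖f‖ + 1) * δ :=
        (norm_hilbertMap_le _ _).trans
          (mul_le_mul ha hgW (norm_nonneg _) (by positivity))
      have e3 := norm_add_le (hilbertMap (f - a) g) (hilbertMap a (g - b))
      nlinarith
  rwa [isClosed_setOfPred_isCompactOperator.closure_eq] at key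

end HilbertTensorMap

/-! ### The complex-conjugate space -/

/-- The complex-conjugate space of `H`: the same additive group, with scalars acting through
complex conjugation. -/
structure ConjSpace (H : Type*) where
  /-- Regard a vector of `H` as a vector of the conjugate space. -/
  mk ::
  /-- Regard a vector of the conjugate space as a vector of `H`. -/
  val : H

namespace ConjSpace

variable {H : Type*}

theorem val_injective : Function.Injective (val : ConjSpace H → H) := by
  rintro ⟨x⟩ ⟨y⟩ h
  exact congrArg mk h

/-- The identity map as a bijection. -/
def equiv : ConjSpace H ≃ H := ⟨val, mk, fun _ => rfl, fun _ => rfl⟩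

variable [NormedAddCommGroup H]

instance : AddCommGroup (ConjSpace H) := equiv.addCommGroup

/-- The identity map as an additive map. -/
def valHom : ConjSpace H →+ H := ⟨⟨val, rfl⟩, fun _ _ => rfl⟩

instance : NormedAddCommGroup (ConjSpace H) :=
  NormedAddCommGroup.induced (ConjSpace H) H valHom val_injective

theorem norm_def (x : ConjSpace H) : ‖x‖ = ‖x.val‖ := rfl

variable [InnerProductSpace ℂ H]

instance : Module ℂ (ConjSpace H) where
  smul c x := ⟨(starRingEnd ℂ c) • x.val⟩
  one_smul x := val_injective (by change (starRingEnd ℂ 1) • x.val = x.val; simp)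
  mul_smul a b x := val_injective (by
    change (starRingEnd ℂ (a * b)) • x.val = (starRingEnd ℂ a) • (starRingEnd ℂ b) • x.val
    rw [map_mul, mul_smul])
  smul_zero a := val_injective (by change (starRingEnd ℂ a) • (0 : H) = 0; simp)
  smul_add a x y := val_injective (smul_add _ x.val y.val)
  add_smul a b x := val_injective (by
    change (starRingEnd ℂ (a + b)) • x.val = (starRingEnd ℂ a) • x.val + (starRingEnd ℂ b) • x.val
    rw [map_add, add_smul])
  zero_smul x := val_injective (by change (starRingEnd ℂ 0) • x.val = 0; simp)

theorem val_smul (c : ℂ) (x : ConjSpace H) : (c • x).val = (starRingEnd ℂ c) • x.val := rfl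

instance : InnerProductSpace ℂ (ConjSpace H) where
  norm_smul_le c x := by rw [norm_def, norm_def, val_smul, norm_smul, RCLike.norm_conj]
  inner x y := ⟪y.val, x.val⟫_ℂ
  norm_sq_eq_re_inner x := norm_sq_eq_re_inner (𝕜 := ℂ) x.val
  conj_inner_symm x y := inner_conj_symm (𝕜 := ℂ) y.val x.val
  add_left x y z := inner_add_right (𝕜 := ℂ) z.val x.val y.val
  smul_left x y c := inner_smul_right (𝕜 := ℂ) y.val x.val ((starRingEnd ℂ) c)

end ConjSpace

/-! ### Amplifications and quantum norms -/

section Amplification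

variable (L : Type*) [NormedAddCommGroup L] [InnerProductSpace ℂ L]

/-- The space `𝓚` of compact operators on `L`. -/
abbrev Compacts : Type _ := compactOperator (RingHom.id ℂ) L L

/-- The amplification `𝓚 ⊗ E` of a linear space `E`. -/
abbrev Ampl (E : Type*) [AddCommGroup E] [Module ℂ E] : Type _ := Compacts L ⊗[ℂ] E

variable {L}

/-- Left multiplication of compact operators by a bounded operator. -/
def mulLeftCompact (a : L →L[ℂ] L) : Compacts L →ₗ[ℂ] Compacts L where
  toFun b := ⟨a ∘L (b : L →L[ℂ] L), IsCompactOperator.clm_comp b.2 a⟩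
  map_add' b c := Subtype.ext (by ext x; simp)
  map_smul' r b := Subtype.ext (by ext x; simp)

/-- Right multiplication of compact operators by a bounded operator. -/
def mulRightCompact (a : L →L[ℂ] L) : Compacts L →ₗ[ℂ] Compacts L where
  toFun b := ⟨(b : L →L[ℂ] L) ∘L a, IsCompactOperator.comp_clm b.2 a⟩
  map_add' b c := Subtype.ext (by ext x; simp)
  map_smul' r b := Subtype.ext (by ext x; simp)

variable {E F G : Type*} [AddCommGroup E] [Module ℂ E] [AddCommGroup F] [Module ℂ F]
  [AddCommGroup G] [Module ℂ G]

/-- The left outer multiplication `a · u` on an amplification; `a · (b ⊗ x) = (ab) ⊗ x`. -/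
def lact (a : L →L[ℂ] L) : Ampl L E →ₗ[ℂ] Ampl L E := (mulLeftCompact a).rTensor E

/-- The right outer multiplication `u · a` on an amplification; `(b ⊗ x) · a = (ba) ⊗ x`. -/
def ract (a : L →L[ℂ] L) : Ampl L E →ₗ[ℂ] Ampl L E := (mulRightCompact a).rTensor E

/-- `P` is a (two-sided) support of `u`: an orthogonal projection with `P · u = u = u · P`. -/
structure IsSupport [CompleteSpace L] (P : L →L[ℂ] L) (u : Ampl L E) : Prop where
  isStarProjection : IsStarProjection P
  left : lact P u = u
  right : ract P u = u

/-- A quantum norm on a linear space `E`: a norm on the amplification of `E` that satisfies both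
axioms of Ruan. A quantum space is a linear space with a quantum norm. -/
structure IsQuantumNorm [CompleteSpace L] (ν : Ampl L E → ℝ) : Prop where
  add_le : ∀ u v, ν (u + v) ≤ ν u + ν v
  smul_eq : ∀ (c : ℂ) u, ν (c • u) = ‖c‖ * ν u
  eq_zero : ∀ u, ν u = 0 → u = 0
  lact_le : ∀ (a : L →L[ℂ] L) u, ν (lact a u) ≤ ‖a‖ * ν u
  ract_le : ∀ (a : L →L[ℂ] L) u, ν (ract a u) ≤ ‖a‖ * ν u
  support_max : ∀ (P Q : L →L[ℂ] L) (u v : Ampl L E), IsSupport P u → IsSupport Q v →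
    P * Q = 0 → ν (u + v) = max (ν u) (ν v)

/-- The amplification `1 ⊗ φ` of a linear operator `φ`. -/
def ampl (φ : E →ₗ[ℂ] F) : Ampl L E →ₗ[ℂ] Ampl L F := φ.lTensor (Compacts L)

/-- `φ` is a completely isometric isomorphism with respect to the given norms on the
amplifications: its amplification is an isometric isomorphism. -/
structure IsCompletelyIsometricIso (ν : Ampl L E → ℝ) (μ : Ampl L F → ℝ) (φ : E →ₗ[ℂ] F) :
    Prop where
  bijective : Function.Bijective (ampl (L := L) φ)
  isometric : ∀ u, μ (ampl φ u) = ν u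

/-! ### Concrete quantum norms, column and row Hilbertians -/

variable {H K : Type*} [NormedAddCommGroup H] [InnerProductSpace ℂ H]
  [NormedAddCommGroup K] [InnerProductSpace ℂ K]

/-- For `I : E → B(H, K)`, the operator `𝓚 ⊗ E → B(L ⊗ H, L ⊗ K)` taking `a ⊗ x` to `a ⊗ I x`. -/
def concreteMap (I : E →ₗ[ℂ] (H →L[ℂ] K)) :
    Ampl L E →ₗ[ℂ] (HilbertTensor L H →L[ℂ] HilbertTensor L K) :=
  TensorProduct.lift ((hilbertMapₗ.compl₂ I) ∘ₗ (compactOperator (RingHom.id ℂ) L L).subtype)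

/-- The concrete quantum norm associated with an injective operator `I : E → B(H, K)`. -/
def concreteNorm (I : E →ₗ[ℂ] (H →L[ℂ] K)) (u : Ampl L E) : ℝ := ‖concreteMap I u‖

theorem concreteMap_tmul (I : E →ₗ[ℂ] (H →L[ℂ] K)) (a : Compacts L) (x : E) :
    concreteMap I (a ⊗ₜ x) = hilbertMap (a : L →L[ℂ] L) (I x) := rfl

theorem concreteMap_lact (I : E →ₗ[ℂ] (H →L[ℂ] K)) (a : L →L[ℂ] L) (u : Ampl L E) :
    concreteMap I (lact a u) = hilbertMap a (.id ℂ K) ∘L concreteMap I u := by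
  induction u using TensorProduct.induction_on with
  | zero => simp
  | add u v hu hv => simp only [map_add, hu, hv, ContinuousLinearMap.comp_add]
  | tmul b x =>
    rw [concreteMap_tmul, ← hilbertMap_comp, ContinuousLinearMap.id_comp]
    rfl

theorem concreteMap_ract (I : E →ₗ[ℂ] (H →L[ℂ] K)) (a : L →L[ℂ] L) (u : Ampl L E) :
    concreteMap I (ract a u) = concreteMap I u ∘L hilbertMap a (.id ℂ H) := by
  induction u using TensorProduct.induction_on with
  | zero => simp
  | add u v hu hv => simp only [map_add, hu, hv, ContinuousLinearMap.add_comp]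
  | tmul b x =>
    rw [concreteMap_tmul, ← hilbertMap_comp, ContinuousLinearMap.comp_id]
    rfl

theorem norm_hilbertMap_id_le (a : L →L[ℂ] L) : ‖hilbertMap a (.id ℂ K)‖ ≤ ‖a‖ :=
  (norm_hilbertMap_le _ _).trans
    (mul_le_of_le_one_right (norm_nonneg _) ContinuousLinearMap.norm_id_le)

theorem inner_hilbertMap_id {P : L →L[ℂ] L} (hP : ∀ x y, ⟪P x, y⟫_ℂ = ⟪x, P y⟫_ℂ)
    (x y : HilbertTensor L K) :
    ⟪hilbertMap P (.id ℂ K) x, y⟫_ℂ = ⟪x, hilbertMap P (.id ℂ K) y⟫_ℂ := by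
  refine HilbertTensor.induction_on
    (p := fun x => ⟪hilbertMap P (.id ℂ K) x, y⟫_ℂ = ⟪x, hilbertMap P (.id ℂ K) y⟫_ℂ) x
    (isClosed_eq (by fun_prop) (by fun_prop)) fun x => ?_
  refine HilbertTensor.induction_on
    (p := fun y => ⟪hilbertMap P (.id ℂ K) (incl L K x), y⟫_ℂ =
      ⟪incl L K x, hilbertMap P (.id ℂ K) y⟫_ℂ) y
    (isClosed_eq (by fun_prop) (by fun_prop)) fun y => ?_
  rw [hilbertMap_incl, hilbertMap_incl, LinearIsometry.inner_map_map, LinearIsometry.inner_map_map]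
  induction x using TensorProduct.induction_on with
  | zero => simp
  | add x x' hx hx' => simp only [map_add, inner_add_left, hx, hx']
  | tmul ξ k =>
    induction y using TensorProduct.induction_on with
    | zero => simp
    | add y y' hy hy' => simp only [map_add, inner_add_right, hy, hy']
    | tmul η k' => simp [hP]

theorem norm_add_sq_of_inner_eq_zero {X : Type*} [NormedAddCommGroup X] [InnerProductSpace ℂ X]
    {x y : X} (h : ⟪x, y⟫_ℂ = 0) : ‖x + y‖ ^ 2 = ‖x‖ ^ 2 + ‖y‖ ^ 2 := by
  have := norm_add_sq_eq_norm_sq_add_norm_sq_of_inner_eq_zero (𝕜 := ℂ) x y h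
  nlinarith

theorem concreteNorm_support_max [CompleteSpace L] (I : E →ₗ[ℂ] (H →L[ℂ] K)) {P Q : L →L[ℂ] L}
    {u v : Ampl L E} (hu : IsSupport P u) (hv : IsSupport Q v) (hPQ : P * Q = 0) :
    concreteNorm I (u + v) = max (concreteNorm I u) (concreteNorm I v) := by
  have hQP : Q * P = 0 := by
    have := congrArg star hPQ
    rwa [star_mul, hu.isStarProjection.isSelfAdjoint.star_eq,
      hv.isStarProjection.isSelfAdjoint.star_eq, star_zero] at this
  have symm : ∀ {R : L →L[ℂ] L}, IsStarProjection R → ∀ x y, ⟪R x, y⟫_ℂ = ⟪x, R y⟫_ℂ :=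
    fun hR x y => by
      exact hR.isSelfAdjoint.isSymmetric x y
  have hsymP := symm hu.isStarProjection
  have hsymQ := symm hv.isStarProjection
  have zeroK : ∀ {R R' : L →L[ℂ] L}, R * R' = 0 → ∀ y : HilbertTensor L K,
      hilbertMap R (.id ℂ K) (hilbertMap R' (.id ℂ K) y) = 0 := fun {R R'} h y => by
    rw [← ContinuousLinearMap.comp_apply, ← hilbertMap_comp]
    change hilbertMap (R * R') _ y = 0
    have h0 := hilbertMap_smul_left (0 : ℂ) R (ContinuousLinearMap.id ℂ K ∘L .id ℂ K)
    rw [h]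
    rw [zero_smul, zero_smul] at h0
    rw [h0, zero_apply]
  have zeroH : ∀ {R R' : L →L[ℂ] L}, R * R' = 0 → ∀ y : HilbertTensor L H,
      hilbertMap R (.id ℂ H) (hilbertMap R' (.id ℂ H) y) = 0 := fun {R R'} h y => by
    rw [← ContinuousLinearMap.comp_apply, ← hilbertMap_comp]
    change hilbertMap (R * R') _ y = 0
    have h0 := hilbertMap_smul_left (0 : ℂ) R (ContinuousLinearMap.id ℂ H ∘L .id ℂ H)
    rw [h]
    rw [zero_smul, zero_smul] at h0
    rw [h0, zero_apply]
  set S := concreteMap I u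
  set T := concreteMap I v
  have hSl : ∀ x, S x = hilbertMap P (.id ℂ K) (S x) := fun x => by
    rw [← ContinuousLinearMap.comp_apply, ← concreteMap_lact, hu.left]
  have hTl : ∀ x, T x = hilbertMap Q (.id ℂ K) (T x) := fun x => by
    rw [← ContinuousLinearMap.comp_apply, ← concreteMap_lact, hv.left]
  have hSr : ∀ x, S x = S (hilbertMap P (.id ℂ H) x) := fun x => by
    rw [← ContinuousLinearMap.comp_apply, ← concreteMap_ract, hu.right]
  have hTr : ∀ x, T x = T (hilbertMap Q (.id ℂ H) x) := fun x => by
    rw [← ContinuousLinearMap.comp_apply, ← concreteMap_ract, hv.right]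
  have hnorm1 : ∀ {R : L →L[ℂ] L}, IsStarProjection R → ‖R‖ ≤ 1 := fun hR => hR.norm_le
  have hPT : ∀ x, hilbertMap P (.id ℂ K) (T x) = 0 := fun x => by rw [hTl, zeroK hPQ]
  have hQS : ∀ x, hilbertMap Q (.id ℂ K) (S x) = 0 := fun x => by rw [hSl, zeroK hQP]
  change ‖concreteMap I (u + v)‖ = max ‖S‖ ‖T‖
  rw [map_add]
  change ‖S + T‖ = max ‖S‖ ‖T‖
  apply le_antisymm
  · refine ContinuousLinearMap.opNorm_le_bound _ (by positivity) fun x => ?_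
    set p := hilbertMap P (.id ℂ H) x
    set q := hilbertMap Q (.id ℂ H) x
    have h1 : ‖S x + T x‖ ^ 2 = ‖S x‖ ^ 2 + ‖T x‖ ^ 2 := by
      apply norm_add_sq_of_inner_eq_zero
      rw [hSl, inner_hilbertMap_id hsymP, hPT, inner_zero_right]
    have h2 : ‖p + q‖ ^ 2 = ‖p‖ ^ 2 + ‖q‖ ^ 2 := by
      apply norm_add_sq_of_inner_eq_zero
      rw [inner_hilbertMap_id hsymP, zeroH hPQ, inner_zero_right]
    have h3 : ‖p + q‖ ≤ ‖x‖ := by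
      have hsum : p + q = hilbertMap (P + Q) (.id ℂ H) x := by
        rw [hilbertMap_add_left, add_apply]
      rw [hsum]
      have hle : ‖hilbertMap (P + Q) (.id ℂ H)‖ ≤ 1 :=
        (norm_hilbertMap_id_le _).trans
          (hnorm1 (hu.isStarProjection.add hv.isStarProjection hPQ))
      exact (ContinuousLinearMap.le_of_opNorm_le _ hle x).trans_eq (one_mul _)
    have h4 : ‖S x‖ ≤ max ‖S‖ ‖T‖ * ‖p‖ := by
      rw [hSr]
      exact (S.le_opNorm _).trans
        (mul_le_mul_of_nonneg_right (le_max_left _ _) (norm_nonneg _))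
    have h5 : ‖T x‖ ≤ max ‖S‖ ‖T‖ * ‖q‖ := by
      rw [hTr]
      exact (T.le_opNorm _).trans
        (mul_le_mul_of_nonneg_right (le_max_right _ _) (norm_nonneg _))
    set m := max ‖S‖ ‖T‖
    have hm : 0 ≤ m := (norm_nonneg S).trans (le_max_left _ _)
    rw [add_apply]
    refine le_of_sq_le_sq ?_ (by positivity)
    have h6 : ‖S x‖ ^ 2 ≤ (m * ‖p‖) ^ 2 := pow_le_pow_left₀ (norm_nonneg _) h4 2
    have h7 : ‖T x‖ ^ 2 ≤ (m * ‖q‖) ^ 2 := pow_le_pow_left₀ (norm_nonneg _) h5 2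
    have h8 : ‖p + q‖ ^ 2 ≤ ‖x‖ ^ 2 := pow_le_pow_left₀ (norm_nonneg _) h3 2
    calc ‖S x + T x‖ ^ 2 ≤ m ^ 2 * (‖p‖ ^ 2 + ‖q‖ ^ 2) := by rw [h1]; linarith
      _ ≤ m ^ 2 * ‖x‖ ^ 2 := by
        rw [← h2]
        exact mul_le_mul_of_nonneg_left h8 (by positivity)
      _ = (m * ‖x‖) ^ 2 := by ring
  · have bound : ∀ {R : L →L[ℂ] L}, IsStarProjection R → ∀ y : HilbertTensor L K,
        ‖hilbertMap R (.id ℂ K) y‖ ≤ ‖y‖ := fun hR y =>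
      (ContinuousLinearMap.le_of_opNorm_le _ ((norm_hilbertMap_id_le _).trans (hnorm1 hR)) y).trans_eq
        (one_mul _)
    refine max_le ?_ ?_
    · refine ContinuousLinearMap.opNorm_le_bound _ (norm_nonneg _) fun x => ?_
      have h := bound hu.isStarProjection ((S + T) x)
      rw [add_apply, map_add, hPT, add_zero, ← hSl, ← add_apply] at h
      exact h.trans ((S + T).le_opNorm x)
    · refine ContinuousLinearMap.opNorm_le_bound _ (norm_nonneg _) fun x => ?_
      have h := bound hv.isStarProjection ((S + T) x)
      rw [add_apply, map_add, hQS, zero_add, ← hTl, ← add_apply] at h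
      exact h.trans ((S + T).le_opNorm x)

/-- The slice map `a ⊗ x ↦ ⟨η, a ξ⟩ x`. -/
def sliceMap (E : Type*) [AddCommGroup E] [Module ℂ E] (ξ η : L) : Ampl L E →ₗ[ℂ] E :=
  TensorProduct.lift (((LinearMap.lsmul ℂ E).comp
    ((innerSL ℂ η : L →L[ℂ] ℂ) : L →ₗ[ℂ] ℂ)).comp
      ((ContinuousLinearMap.apply ℂ L ξ : (L →L[ℂ] L) →L[ℂ] L).toLinearMap.comp
        (compactOperator (RingHom.id ℂ) L L).subtype))

theorem sliceMap_tmul (ξ η : L) (a : Compacts L) (x : E) :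
    sliceMap E ξ η (a ⊗ₜ x) = ⟪η, (a : L →L[ℂ] L) ξ⟫_ℂ • x := rfl

theorem eq_zero_of_sliceMap {u : Ampl L E} (h : ∀ ξ η, sliceMap E ξ η u = 0) : u = 0 := by
  classical
  let b := Module.Basis.ofVectorSpace ℂ E
  let e : Ampl L E →ₗ[ℂ] _ →₀ Compacts L := (TensorProduct.equivFinsuppOfBasisRight b).toLinearMap
  have key : ∀ (w : Ampl L E) (ξ η : L) i, b.repr (sliceMap E ξ η w) i =
      ⟪η, ((e w i : Compacts L) : L →L[ℂ] L) ξ⟫_ℂ := by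
    intro w ξ η i
    induction w using TensorProduct.induction_on with
    | zero => simp
    | add x y hx hy => simp only [map_add, Finsupp.add_apply, hx, hy, Submodule.coe_add,
        add_apply, inner_add_right]
    | tmul a x =>
      have h1 : e (a ⊗ₜ x) i = b.repr x i • a :=
        TensorProduct.equivFinsuppOfBasisRight_apply_tmul_apply b a x i
      rw [sliceMap_tmul, h1]
      simp [mul_comm]
  have he : e u = 0 := by
    ext i : 1
    apply Subtype.ext
    ext ξ
    rw [Finsupp.zero_apply, Submodule.coe_zero, zero_apply]
    refine ext_inner_left ℂ fun η => ?_
    rw [← key, h, map_zero, Finsupp.zero_apply, inner_zero_right]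
  exact (TensorProduct.equivFinsuppOfBasisRight b).injective
    (he.trans (LinearEquiv.map_zero (TensorProduct.equivFinsuppOfBasisRight b)).symm)

theorem inner_concreteMap (I : E →ₗ[ℂ] (H →L[ℂ] K)) (u : Ampl L E) (ξ η : L) (h : H) (k : K) :
    ⟪incl L K (η ⊗ₜ k), concreteMap I u (incl L H (ξ ⊗ₜ h))⟫_ℂ =
      ⟪k, I (sliceMap E ξ η u) h⟫_ℂ := by
  induction u using TensorProduct.induction_on with
  | zero => simp
  | add u v hu hv => simp only [map_add, add_apply, inner_add_right, hu, hv]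
  | tmul a x =>
    rw [concreteMap_tmul, hilbertMap_incl, LinearIsometry.inner_map_map, TensorProduct.mapL_tmul,
      TensorProduct.inner_tmul, sliceMap_tmul, map_smul, smul_apply, inner_smul_right]

/-- The concrete quantum norm associated with an injective operator is a quantum norm. -/
theorem concreteNorm_isQuantumNorm [CompleteSpace L] (I : E →ₗ[ℂ] (H →L[ℂ] K))
    (hI : Function.Injective I) : IsQuantumNorm (L := L) (concreteNorm I) where
  add_le u v := by
    unfold concreteNorm
    rw [map_add]
    exact norm_add_le _ _
  smul_eq c u := by
    unfold concreteNorm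
    rw [map_smul, norm_smul]
  eq_zero u hu := by
    have h0 : concreteMap I u = 0 := norm_eq_zero.1 hu
    refine eq_zero_of_sliceMap fun ξ η => hI ?_
    rw [map_zero]
    ext h
    refine ext_inner_left ℂ fun k => ?_
    rw [← inner_concreteMap, h0, zero_apply, zero_apply, inner_zero_right, inner_zero_right]
  lact_le a u := by
    unfold concreteNorm
    rw [concreteMap_lact]
    exact (ContinuousLinearMap.opNorm_comp_le _ _).trans
      (mul_le_mul_of_nonneg_right (norm_hilbertMap_id_le a) (norm_nonneg _))
  ract_le a u := by
    unfold concreteNorm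
    rw [concreteMap_ract, mul_comm]
    exact (ContinuousLinearMap.opNorm_comp_le _ _).trans
      (mul_le_mul_of_nonneg_left (norm_hilbertMap_id_le a) (norm_nonneg _))
  support_max _ _ _ _ hu hv h := concreteNorm_support_max I hu hv h

/-- The operator `I_c : H → B(ℂ, H)` taking `x` to `1 ↦ x`. -/
def columnEmbedding (H : Type*) [NormedAddCommGroup H] [InnerProductSpace ℂ H] :
    H →ₗ[ℂ] (ℂ →L[ℂ] H) where
  toFun x := (ContinuousLinearMap.id ℂ ℂ).smulRight x
  map_add' x y := by ext; simp
  map_smul' c x := by ext; simp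

/-- The operator `I_r : H → B(H̄, ℂ)` taking `x` to the functional `y ↦ ⟨x, y⟩`, where the inner
product is linear in `x` and antilinear in `y`. -/
def rowEmbedding (H : Type*) [NormedAddCommGroup H] [InnerProductSpace ℂ H] :
    H →ₗ[ℂ] (ConjSpace H →L[ℂ] ℂ) where
  toFun x := LinearMap.mkContinuous
    { toFun := fun y => ⟪y.val, x⟫_ℂ
      map_add' := fun y z => inner_add_left (𝕜 := ℂ) y.val z.val x
      map_smul' := fun c y => by
        rw [ConjSpace.val_smul, inner_smul_left, starRingEnd_self_apply]
        rfl } ‖x‖ fun y => by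
      rw [mul_comm]
      exact norm_inner_le_norm (𝕜 := ℂ) y.val x
  map_add' x y := by
    ext z
    exact inner_add_right (𝕜 := ℂ) z.val x y
  map_smul' c x := by
    ext z
    exact inner_smul_right (𝕜 := ℂ) z.val x c

theorem columnEmbedding_apply (x : H) (c : ℂ) : columnEmbedding H x c = c • x := rfl

theorem rowEmbedding_apply (x : H) (y : ConjSpace H) : rowEmbedding H x y = ⟪y.val, x⟫_ℂ := rfl

variable (L H) in
/-- The quantum norm of the column Hilbertian `H_c`. -/
def columnNorm : Ampl L H → ℝ := concreteNorm (columnEmbedding H)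

variable (L H) in
/-- The quantum norm of the row Hilbertian `H_r`. -/
def rowNorm : Ampl L H → ℝ := concreteNorm (rowEmbedding H)

theorem columnNorm_isQuantumNorm [CompleteSpace L] : IsQuantumNorm (columnNorm L H) :=
  concreteNorm_isQuantumNorm _ fun _ _ h => by
    simpa [columnEmbedding_apply] using DFunLike.congr_fun h (1 : ℂ)

theorem rowNorm_isQuantumNorm [CompleteSpace L] : IsQuantumNorm (rowNorm L H) :=
  concreteNorm_isQuantumNorm _ fun _ _ h =>
    ext_inner_left ℂ fun z => DFunLike.congr_fun h (ConjSpace.mk z)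

/-! ### The Haagerup and the four-named tensor products -/

/-- Composition of compact operators as a bilinear map. -/
def compactMul : Compacts L →ₗ[ℂ] Compacts L →ₗ[ℂ] Compacts L :=
  LinearMap.mk₂ ℂ (fun a b => ⟨(a : L →L[ℂ] L) ∘L (b : L →L[ℂ] L), IsCompactOperator.comp_clm a.2 _⟩)
    (fun a a' b => Subtype.ext (by ext x; simp)) (fun c a b => Subtype.ext (by ext x; simp))
    (fun a b b' => Subtype.ext (by ext x; simp)) (fun c a b => Subtype.ext (by ext x; simp))

/-- The operator `a ◇ b = ι* (a ⊗ b) ι` on `L`, where `ι : L → L ⊗ L` is unitary. -/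
def diamond (ι : L ≃ₗᵢ[ℂ] HilbertTensor L L) (a b : L →L[ℂ] L) : L →L[ℂ] L :=
  (ι.symm.toContinuousLinearEquiv : HilbertTensor L L →L[ℂ] L) ∘L
    (hilbertMap a b ∘L (ι.toContinuousLinearEquiv : L →L[ℂ] HilbertTensor L L))

theorem diamond_apply (ι : L ≃ₗᵢ[ℂ] HilbertTensor L L) (a b : L →L[ℂ] L) (x : L) :
    diamond ι a b x = ι.symm (hilbertMap a b (ι x)) := rfl

/-- The operation `◇` on compact operators as a bilinear map. -/
def compactDiamond [CompleteSpace L] (ι : L ≃ₗᵢ[ℂ] HilbertTensor L L) :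
    Compacts L →ₗ[ℂ] Compacts L →ₗ[ℂ] Compacts L :=
  LinearMap.mk₂ ℂ
    (fun a b => ⟨diamond ι a b,
      ((hilbertMap_compact a.2 b.2).comp_clm
        (ι.toContinuousLinearEquiv : L →L[ℂ] HilbertTensor L L)).clm_comp
          (ι.symm.toContinuousLinearEquiv : HilbertTensor L L →L[ℂ] L)⟩)
    (fun a a' b => Subtype.ext (by ext x; simp [diamond_apply, hilbertMap_add_left]))
    (fun c a b => Subtype.ext (by ext x; simp [diamond_apply, hilbertMap_smul_left]))
    (fun a b b' => Subtype.ext (by ext x; simp [diamond_apply, hilbertMap_add_right]))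
    (fun c a b => Subtype.ext (by ext x; simp [diamond_apply, hilbertMap_smul_right]))

/-- The strong amplification of a bilinear operator `R`; it takes `(a ⊗ x, b ⊗ y)` to
`(ab) ⊗ R(x, y)`. -/
def strongAmpl (R : E →ₗ[ℂ] F →ₗ[ℂ] G) : Ampl L E →ₗ[ℂ] Ampl L F →ₗ[ℂ] Ampl L G :=
  TensorProduct.map₂ compactMul R

/-- The weak amplification of a bilinear operator `R`; it takes `(a ⊗ x, b ⊗ y)` to
`(a ◇ b) ⊗ R(x, y)`. -/
def weakAmpl [CompleteSpace L] (ι : L ≃ₗᵢ[ℂ] HilbertTensor L L) (R : E →ₗ[ℂ] F →ₗ[ℂ] G) :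
    Ampl L E →ₗ[ℂ] Ampl L F →ₗ[ℂ] Ampl L G :=
  TensorProduct.map₂ (compactDiamond ι) R

theorem strongAmpl_tmul (R : E →ₗ[ℂ] F →ₗ[ℂ] G) (a b : Compacts L) (x : E) (y : F) :
    strongAmpl R (a ⊗ₜ x) (b ⊗ₜ y) = compactMul a b ⊗ₜ R x y := rfl

theorem weakAmpl_tmul [CompleteSpace L] (ι : L ≃ₗᵢ[ℂ] HilbertTensor L L)
    (R : E →ₗ[ℂ] F →ₗ[ℂ] G) (a b : Compacts L) (x : E) (y : F) :
    weakAmpl ι R (a ⊗ₜ x) (b ⊗ₜ y) = compactDiamond ι a b ⊗ₜ R x y := rfl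

/-- The Effros symbol `u ⊙ v`: the strong amplification of `(x, y) ↦ x ⊗ y`. -/
def effros (u : Ampl L E) (v : Ampl L F) : Ampl L (E ⊗[ℂ] F) :=
  strongAmpl (TensorProduct.mk ℂ E F) u v

/-- The element `u ◇ v`: the weak amplification of `(x, y) ↦ x ⊗ y`. -/
def diamondTensor [CompleteSpace L] (ι : L ≃ₗᵢ[ℂ] HilbertTensor L L) (u : Ampl L E) (v : Ampl L F) :
    Ampl L (E ⊗[ℂ] F) :=
  weakAmpl ι (TensorProduct.mk ℂ E F) u v

/-- The norm of the Haagerup tensor product `E ⊗_h F` on the amplification of `E ⊗ F`: the infimum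
of `∑ ‖u_k‖ ‖v_k‖` over all representations `U = ∑ u_k ⊙ v_k`. -/
def haagerupNorm (ν : Ampl L E → ℝ) (μ : Ampl L F → ℝ) (U : Ampl L (E ⊗[ℂ] F)) : ℝ :=
  sInf {r : ℝ | ∃ (n : ℕ) (u : Fin n → Ampl L E) (v : Fin n → Ampl L F),
    U = ∑ k, effros (u k) (v k) ∧ r = ∑ k, ν (u k) * μ (v k)}

/-- The norm of the four-named tensor product `E ⊗_4 F` on the amplification of `E ⊗ F`: the infimum
of `∑ ‖a_k‖ ‖u_k‖ ‖v_k‖ ‖b_k‖` over all representations `U = ∑ a_k · (u_k ◇ v_k) · b_k` with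
compact `a_k`, `b_k`. -/
def fourNorm [CompleteSpace L] (ι : L ≃ₗᵢ[ℂ] HilbertTensor L L) (ν : Ampl L E → ℝ)
    (μ : Ampl L F → ℝ) (U : Ampl L (E ⊗[ℂ] F)) : ℝ :=
  sInf {r : ℝ | ∃ (n : ℕ) (a : Fin n → Compacts L) (u : Fin n → Ampl L E) (v : Fin n → Ampl L F)
    (b : Fin n → Compacts L),
    U = ∑ k, lact (a k : L →L[ℂ] L) (ract (b k : L →L[ℂ] L) (diamondTensor ι (u k) (v k))) ∧
    r = ∑ k, ‖a k‖ * ν (u k) * μ (v k) * ‖b k‖}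

end Amplification

/-!
The two norms on `𝓚 ⊗ (E ⊗ F)` are infima of costs of representations, and they are compared by
converting representations of one kind into the other without raising the cost.

For a vector `e` of `L` let `S e : L → L` be the operator `x ↦ ι* (x ⊗ e)` (`leg ι e`). Then
`(S e)* (S f) = ⟨e, f⟩ 1`, `(c ◇ d) (S e) = S (d e) c`, and `c ◇ |f⟩⟨e| = (S f) c (S e)*`.

The inequality `‖·‖_h ≤ ‖·‖_4` holds for arbitrary quantum spaces. It rests on the identity
`a · (u ◇ v) · b = (a · (u ◇ 1)) ⊙ ((1 ◇ v) · b)` (`lact_ract_diamondTensor`) and on the estimate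
`‖a · (u ◇ 1)‖ ≤ ‖a‖ ‖u‖` (`IsQuantumNorm.lactDiamondOne_le`) with its counterpart for `1 ◇ v`. To
prove the estimate, replace `1` by a projection `p` onto the span of finitely many vectors of an
orthonormal basis: `u ◇ p` is the sum of the copies `S e · u · (S e)*` of `u`, which have orthogonal
supports, so its norm is at most `‖u‖` by the second axiom of Ruan. The error `a · (u ◇ (1 - p))`
becomes small, because the compact operator `a` is a product of two compact operators
(`IsCompactOperator.exists_mul`), one of which absorbs `1 - p` in operator norm while the other one
keeps the element inside the amplification.

The inequality `‖·‖_4 ≤ ‖·‖_h` uses the Hilbertian factor. Write `v = ∑ cⱼ ⊗ yⱼ` with orthonormal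
`yⱼ`, choose orthonormal `eⱼ` and a unit vector `f` in `L`, and put `b = ∑ S eⱼ cⱼ` and
`v' = ∑ |f⟩⟨eⱼ| ⊗ yⱼ`. In the column Hilbertian `‖b‖ ≤ ‖v‖` and `‖v'‖ ≤ 1`, and
`(d · w) ⊙ v = (d (S f)*) · (w ◇ v') · b` (`effros_lact_sum`). The compact operator `d` is needed to
make the left coefficient compact, and every `u` is a sum of such products `d · w` at almost no cost
in norm (`IsQuantumNorm.exists_sum_lact_le`). The row case is the mirror image, with the factors of
`L ⊗ L` interchanged (`swapped ι`).
-/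

/-! ### Compact operators on a Hilbert space -/

section CompactOperators

open Filter Topology

variable {L : Type*} [NormedAddCommGroup L] [InnerProductSpace ℂ L]

theorem isStarProjection_sum {A κ : Type*} [Ring A] [StarRing A] {p : κ → A}
    (hp : ∀ i, IsStarProjection (p i)) (hort : ∀ i j, i ≠ j → p i * p j = 0) (F : Finset κ) :
    IsStarProjection (∑ i ∈ F, p i) := by
  classical
  induction F using Finset.induction_on with
  | empty => simp
  | insert i F hi ih =>
    rw [Finset.sum_insert hi]
    refine (hp i).add ih ?_
    rw [Finset.mul_sum]
    exact Finset.sum_eq_zero fun j hj => hort i j (ne_of_mem_of_not_mem hj hi).symm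

theorem isCompactOperator_starProjection (V : Submodule ℂ L) [FiniteDimensional ℂ V] :
    IsCompactOperator V.starProjection :=
  isCompactOperator_of_factor V.subtypeL V.orthogonalProjectionOnto

/-- A net of contractions that converges strongly to zero converges to zero in norm after
multiplication by a compact operator on the right. -/
theorem tendsto_norm_mul_compact {κ : Type*} {l : Filter κ} {T : κ → L →L[ℂ] L}
    (hT : ∀ i, ‖T i‖ ≤ 1) (h0 : ∀ x, Tendsto (fun i => T i x) l (𝓝 0)) {c : L →L[ℂ] L}
    (hc : IsCompactOperator c) : Tendsto (fun i => ‖T i * c‖) l (𝓝 0) := by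
  rw [Metric.tendsto_nhds]
  intro ε hε
  obtain ⟨t, ht, hcov⟩ := Metric.totallyBounded_iff.1
    (IsCompactOperator.isCompact_closure_image_closedBall
      (f := (c : L →ₗ[ℂ] L)) hc 1).totallyBounded (ε / 4) (by positivity)
  have hev : ∀ᶠ i in l, ∀ y ∈ t, ‖T i y‖ < ε / 4 := by
    rw [eventually_all_finite ht]
    intro y _
    have := (h0 y).norm
    rw [norm_zero] at this
    exact this.eventually_lt_const (by positivity)
  filter_upwards [hev] with i hi
  rw [Real.dist_eq, sub_zero, abs_of_nonneg (norm_nonneg _)]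
  refine lt_of_le_of_lt (b := ε / 2) ?_ (by linarith)
  refine ContinuousLinearMap.opNorm_le_of_unit_norm (𝕜 := ℂ) (by positivity) fun x hx => ?_
  have hx' : c x ∈ closure ((c : L →ₗ[ℂ] L) '' Metric.closedBall 0 1) :=
    subset_closure ⟨x, by simp [hx], rfl⟩
  obtain ⟨y, hy, hxy⟩ := Set.mem_iUnion₂.1 (hcov hx')
  have hxy : ‖c x - y‖ < ε / 4 := by rwa [Metric.mem_ball, dist_eq_norm] at hxy
  have h1 : ‖T i (c x - y)‖ ≤ ‖c x - y‖ := by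
    simpa using (T i).le_of_opNorm_le (hT i) (c x - y)
  have h2 : ‖T i (c x)‖ ≤ ‖T i (c x - y)‖ + ‖T i y‖ := by
    have := norm_add_le (T i (c x - y)) (T i y)
    rwa [← map_add, sub_add_cancel] at this
  have := hi y hy
  rw [mul_apply_eq_comp]
  linarith

/-- The operators of finite rank. -/
def finiteRankOperators (L : Type*) [NormedAddCommGroup L] [InnerProductSpace ℂ L] :
    AddSubgroup (L →L[ℂ] L) where
  carrier := {f | ∃ V : Submodule ℂ L, FiniteDimensional ℂ V ∧ ∀ x, f x ∈ V}
  zero_mem' := ⟨⊥, inferInstance, by simp⟩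
  add_mem' := by
    rintro f g ⟨V, hV, hf⟩ ⟨W, hW, hg⟩
    exact ⟨V ⊔ W, inferInstance, fun x => add_mem (Submodule.mem_sup_left (hf x))
      (Submodule.mem_sup_right (hg x))⟩
  neg_mem' := by
    rintro f ⟨V, hV, hf⟩
    exact ⟨V, hV, fun x => neg_mem (hf x)⟩

/-- A finite-rank operator is fixed by left multiplication by some compact contraction, namely the
orthogonal projection onto a finite-dimensional subspace that contains its range. -/
theorem exists_compact_mul_eq_of_mem_finiteRankOperators {f : L →L[ℂ] L}
    (hf : f ∈ finiteRankOperators L) : ∃ r : L →L[ℂ] L, ‖r‖ ≤ 1 ∧ IsCompactOperator r ∧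
      r * f = f := by
  obtain ⟨V, hV, hf⟩ := hf
  refine ⟨V.starProjection, V.starProjection_norm_le, isCompactOperator_starProjection V, ?_⟩
  ext x
  exact Submodule.starProjection_eq_self_iff.2 (hf x)

variable [CompleteSpace L]

/-- Schauder's theorem for operators on a Hilbert space. -/
theorem IsCompactOperator.star_clm {a : L →L[ℂ] L} (ha : IsCompactOperator a) :
    IsCompactOperator (star a : L →L[ℂ] L) := by
  have key : star a ∈ closure {T : L →L[ℂ] L | IsCompactOperator T} := by
    refine Metric.mem_closure_iff.2 fun ε hε => ?_
    obtain ⟨V, hV, h⟩ := exists_projection_close ha (half_pos hε)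
    refine ⟨star (V.starProjection * a), ?_, ?_⟩
    · rw [star_mul, isStarProjection_starProjection.isSelfAdjoint.star_eq]
      exact (isCompactOperator_starProjection V).clm_comp (star a)
    · rw [dist_eq_norm, ← star_sub, norm_star]
      exact lt_of_le_of_lt h (half_lt_self hε)
  rwa [isClosed_setOfPred_isCompactOperator.closure_eq] at key

/-- The version of `tendsto_norm_mul_compact` with the compact operator on the left. -/
theorem tendsto_norm_compact_mul {κ : Type*} {l : Filter κ} {T : κ → L →L[ℂ] L}
    (hT : ∀ i, ‖T i‖ ≤ 1) (hsa : ∀ i, star (T i) = T i)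
    (h0 : ∀ x, Tendsto (fun i => T i x) l (𝓝 0)) {c : L →L[ℂ] L}
    (hc : IsCompactOperator c) : Tendsto (fun i => ‖c * T i‖) l (𝓝 0) := by
  refine (tendsto_norm_mul_compact hT h0 hc.star_clm).congr fun i => ?_
  rw [← norm_star, star_mul, star_star, hsa]

theorem IsCompactOperator.mem_closure_finiteRankOperators {c : L →L[ℂ] L}
    (hc : IsCompactOperator c) : c ∈ closure (finiteRankOperators L : Set (L →L[ℂ] L)) := by
  refine Metric.mem_closure_iff.2 fun ε hε => ?_
  obtain ⟨V, hV, h⟩ := exists_projection_close hc (half_pos hε)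
  refine ⟨V.subtypeL ∘L (V.orthogonalProjectionOnto ∘L c), ⟨V, hV, fun x => ?_⟩, ?_⟩
  · exact (V.orthogonalProjectionOnto (c x)).2
  · rw [dist_eq_norm]
    exact lt_of_le_of_lt h (half_lt_self hε)

theorem isCompactOperator_tsum {f : ℕ → L →L[ℂ] L} (hf : ∀ n, IsCompactOperator (f n))
    (hs : Summable f) : IsCompactOperator (∑' n, f n : L →L[ℂ] L) :=
  isCompactOperator_of_tendsto hs.hasSum.tendsto_sum_nat <| Eventually.of_forall fun _ =>
    Submodule.sum_mem (compactOperator (RingHom.id ℂ) L L) fun i _ => hf i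

/-- Every compact operator is a product of two compact operators. With `c = ∑ cₙ` a rapidly
convergent series of operators of finite rank, `rₙ` compact contractions with `rₙ cₙ = cₙ`, and
`Sₙ` isometries with orthogonal ranges, the factors are `∑ 2⁻ⁿ rₙ Sₙ*` and `∑ 2ⁿ Sₙ cₙ`. -/
theorem IsCompactOperator.exists_mul {S : ℕ → L →L[ℂ] L} (hS : ∀ i, star (S i) * S i = 1)
    (hSo : ∀ i j, i ≠ j → star (S i) * S j = 0) {c : L →L[ℂ] L} (hc : IsCompactOperator c) :
    ∃ d g : L →L[ℂ] L, IsCompactOperator d ∧ IsCompactOperator g ∧ d * g = c := by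
  -- The terms decay like `4⁻ⁿ`, so the series for the second factor converges despite the `2ⁿ`.
  obtain ⟨v, hlim, hv, -, hbound⟩ := controlled_sum_of_mem_closure
    hc.mem_closure_finiteRankOperators (b := fun n => (1 / 4 : ℝ) ^ n) fun n => by positivity
  choose r hr1 hrc hrv using fun n => exists_compact_mul_eq_of_mem_finiteRankOperators (hv n)
  have hSn : ∀ i, ‖S i‖ ≤ 1 := fun i => by
    have h := CStarRing.norm_star_mul_self (x := S i)
    rw [hS] at h
    have h1 : ‖(1 : L →L[ℂ] L)‖ ≤ 1 := ContinuousLinearMap.norm_id_le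
    nlinarith [norm_nonneg (S i)]
  -- The term `v 0` is not covered by `hbound`, whence the constant.
  have hvb : ∀ n, ‖v n‖ ≤ (‖v 0‖ + 1) * (1 / 4 : ℝ) ^ n := fun n => by
    rcases Nat.eq_zero_or_pos n with rfl | hn
    · simp
    · have h := (hbound n hn).le
      have : (0 : ℝ) ≤ (1 / 4 : ℝ) ^ n := by positivity
      nlinarith [norm_nonneg (v 0)]
  have hsd : Summable fun n => ((1 / 2 : ℂ) ^ n) • (r n * star (S n)) := by
    refine Summable.of_norm_bounded (g := fun n => (1 / 2 : ℝ) ^ n)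
      (summable_geometric_of_lt_one (by norm_num) (by norm_num)) fun n => ?_
    rw [norm_smul, norm_pow]
    have h1 : ‖r n * star (S n)‖ ≤ 1 := (norm_mul_le _ _).trans
      (mul_le_one₀ (hr1 n) (norm_nonneg _) (by rw [norm_star]; exact hSn n))
    calc _ ≤ ‖(1 / 2 : ℂ)‖ ^ n * 1 := by gcongr
      _ = _ := by norm_num
  have hsg : Summable fun n => ((2 : ℂ) ^ n) • (S n * v n) := by
    refine Summable.of_norm_bounded (g := fun n => (‖v 0‖ + 1) * (1 / 2 : ℝ) ^ n)
      ((summable_geometric_of_lt_one (by norm_num) (by norm_num)).mul_left _) fun n => ?_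
    rw [norm_smul, norm_pow]
    have h1 : ‖S n * v n‖ ≤ ‖v n‖ := (norm_mul_le _ _).trans
      (mul_le_of_le_one_left (norm_nonneg _) (hSn n))
    calc _ ≤ ‖(2 : ℂ)‖ ^ n * ((‖v 0‖ + 1) * (1 / 4 : ℝ) ^ n) := by
          gcongr
          exact h1.trans (hvb n)
      _ = (‖v 0‖ + 1) * (‖(2 : ℂ)‖ * (1 / 4)) ^ n := by rw [mul_pow]; ring
      _ = _ := by norm_num
  have hvc : ∀ n, IsCompactOperator (v n) := fun n => by
    rw [← hrv n]
    exact (hrc n).comp_clm (v n)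
  refine ⟨_, _, isCompactOperator_tsum (fun n => ?_) hsd, isCompactOperator_tsum (fun n => ?_) hsg,
    ?_⟩
  · exact ((hrc n).comp_clm (star (S n))).smul ((1 / 2 : ℂ) ^ n)
  · exact ((hvc n).clm_comp (S n)).smul ((2 : ℂ) ^ n)
  · have hdS : ∀ n, (∑' m, ((1 / 2 : ℂ) ^ m) • (r m * star (S m))) * S n =
        ((1 / 2 : ℂ) ^ n) • r n := fun n => by
      rw [← hsd.tsum_mul_right, tsum_eq_single n fun m hm => ?_]
      · rw [smul_mul_assoc, mul_assoc, hS, mul_one]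
      · rw [smul_mul_assoc, mul_assoc, hSo m n hm, mul_zero, smul_zero]
    have hterm : ∀ n, (∑' m, ((1 / 2 : ℂ) ^ m) • (r m * star (S m))) *
        (((2 : ℂ) ^ n) • (S n * v n)) = v n := fun n => by
      rw [mul_smul_comm, ← mul_assoc, hdS, smul_mul_assoc, hrv, smul_smul, ← mul_pow]
      norm_num
    have h := hsg.hasSum.mul_left (∑' m, ((1 / 2 : ℂ) ^ m) • (r m * star (S m)))
    simp only [hterm] at h
    exact tendsto_nhds_unique (h.tendsto_sum_nat.comp (tendsto_add_atTop_nat 1)) hlim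

end CompactOperators

/-! ### The isometries `x ↦ ι* (x ⊗ e)` -/

section Legs

open Filter Topology InnerProductSpace

variable {L : Type*} [NormedAddCommGroup L] [InnerProductSpace ℂ L]

/-- The operator `x ↦ ι* (x ⊗ e)` on `L`. -/
def leg (ι : L ≃ₗᵢ[ℂ] HilbertTensor L L) (e : L) : L →L[ℂ] L :=
  (ι.symm.toContinuousLinearEquiv : HilbertTensor L L →L[ℂ] L) ∘L
    ((incl L L).toContinuousLinearMap ∘L (TensorProduct.mkL ℂ L L).flip e)

theorem leg_apply (ι : L ≃ₗᵢ[ℂ] HilbertTensor L L) (e x : L) :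
    leg ι e x = ι.symm (incl L L (x ⊗ₜ e)) := rfl

theorem diamond_leg_apply (ι : L ≃ₗᵢ[ℂ] HilbertTensor L L) (c d : L →L[ℂ] L) (e x : L) :
    diamond ι c d (leg ι e x) = leg ι (d e) (c x) := by
  rw [leg_apply, diamond_apply, ι.apply_symm_apply, hilbertMap_incl, TensorProduct.mapL_tmul,
    leg_apply]

theorem diamond_mul_leg (ι : L ≃ₗᵢ[ℂ] HilbertTensor L L) (c d : L →L[ℂ] L) (e : L) :
    diamond ι c d * leg ι e = leg ι (d e) * c := by
  ext x
  exact diamond_leg_apply ι c d e x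

/-- Bounded operators on `L` that agree on the vectors `ι* (x ⊗ y)` coincide. -/
theorem ext_leg (ι : L ≃ₗᵢ[ℂ] HilbertTensor L L) {A B : L →L[ℂ] L}
    (h : ∀ e x, A (leg ι e x) = B (leg ι e x)) : A = B := by
  have key : A ∘L (ι.symm.toContinuousLinearEquiv : HilbertTensor L L →L[ℂ] L) =
      B ∘L (ι.symm.toContinuousLinearEquiv : HilbertTensor L L →L[ℂ] L) := by
    refine hilbert_ext fun z => ?_
    induction z using TensorProduct.induction_on with
    | zero => simp
    | add z w hz hw => simp only [map_add, hz, hw]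
    | tmul x e => exact h e x
  ext x
  have := DFunLike.congr_fun key (ι x)
  simpa using this

theorem diamond_mul_diamond (ι : L ≃ₗᵢ[ℂ] HilbertTensor L L) (a b c d : L →L[ℂ] L) :
    diamond ι a b * diamond ι c d = diamond ι (a * c) (b * d) :=
  ext_leg ι fun e x => by simp [diamond_leg_apply]

/-- The bounded operator `x ⊗ y ↦ y ⊗ x`. -/
def hilbertSwapL (L : Type*) [NormedAddCommGroup L] [InnerProductSpace ℂ L] :
    HilbertTensor L L →L[ℂ] HilbertTensor L L :=
  fromHilbert ((incl L L).toContinuousLinearMap ∘L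
    (TensorProduct.commIsometry ℂ L L).toLinearIsometry.toContinuousLinearMap)

theorem hilbertSwapL_incl (z : L ⊗[ℂ] L) :
    hilbertSwapL L (incl L L z) = incl L L (TensorProduct.commIsometry ℂ L L z) :=
  fromHilbert_incl _ z

theorem hilbertSwapL_hilbertSwapL (z : HilbertTensor L L) :
    hilbertSwapL L (hilbertSwapL L z) = z := by
  refine DFunLike.congr_fun (hilbert_ext (S := hilbertSwapL L ∘L hilbertSwapL L)
    (T := ContinuousLinearMap.id ℂ (HilbertTensor L L)) fun w => ?_) z
  rw [ContinuousLinearMap.comp_apply, hilbertSwapL_incl, hilbertSwapL_incl]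
  exact congrArg (incl L L) ((TensorProduct.comm ℂ L L).symm_apply_apply w)

theorem norm_hilbertSwapL (z : HilbertTensor L L) : ‖hilbertSwapL L z‖ = ‖z‖ :=
  HilbertTensor.induction_on (p := fun z => ‖hilbertSwapL L z‖ = ‖z‖) z
    (isClosed_eq (by fun_prop) (by fun_prop)) fun w => by
      rw [hilbertSwapL_incl, LinearIsometry.norm_map, LinearIsometry.norm_map,
        LinearIsometryEquiv.norm_map]

/-- The isometry `x ⊗ y ↦ y ⊗ x`. -/
def hilbertSwap (L : Type*) [NormedAddCommGroup L] [InnerProductSpace ℂ L] :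
    HilbertTensor L L ≃ₗᵢ[ℂ] HilbertTensor L L where
  toLinearEquiv := LinearEquiv.ofInvolutive (hilbertSwapL L).toLinearMap hilbertSwapL_hilbertSwapL
  norm_map' := norm_hilbertSwapL

theorem hilbertSwap_incl_tmul (x y : L) :
    hilbertSwap L (incl L L (x ⊗ₜ y)) = incl L L (y ⊗ₜ x) :=
  hilbertSwapL_incl _

theorem hilbertSwap_symm_incl_tmul (x y : L) :
    (hilbertSwap L).symm (incl L L (x ⊗ₜ y)) = incl L L (y ⊗ₜ x) := by
  rw [LinearIsometryEquiv.symm_apply_eq, hilbertSwap_incl_tmul]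

/-- The identification of `L` with `L ⊗ L` with the two factors interchanged. -/
def swapped (ι : L ≃ₗᵢ[ℂ] HilbertTensor L L) : L ≃ₗᵢ[ℂ] HilbertTensor L L :=
  ι.trans (hilbertSwap L)

theorem leg_swapped (ι : L ≃ₗᵢ[ℂ] HilbertTensor L L) (e x : L) :
    leg (swapped ι) e x = leg ι x e := by
  simp [leg_apply, swapped, hilbertSwap_symm_incl_tmul]

theorem diamond_swapped (ι : L ≃ₗᵢ[ℂ] HilbertTensor L L) (c d : L →L[ℂ] L) :
    diamond (swapped ι) c d = diamond ι d c :=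
  ext_leg ι fun e x => by
    rw [← leg_swapped, diamond_leg_apply, leg_swapped, leg_swapped, diamond_leg_apply]

variable {κ : Type*}

theorem inner_leg_leg (ι : L ≃ₗᵢ[ℂ] HilbertTensor L L) (e f x y : L) :
    ⟪leg ι e x, leg ι f y⟫_ℂ = ⟪x, y⟫_ℂ * ⟪e, f⟫_ℂ := by
  rw [leg_apply, leg_apply, LinearIsometryEquiv.inner_map_map, LinearIsometry.inner_map_map,
    TensorProduct.inner_tmul]

theorem norm_leg (ι : L ≃ₗᵢ[ℂ] HilbertTensor L L) {e : L} (he : ‖e‖ = 1) : ‖leg ι e‖ ≤ 1 :=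
  ContinuousLinearMap.opNorm_le_bound _ zero_le_one fun x => by
    rw [leg_apply, LinearIsometryEquiv.norm_map, LinearIsometry.norm_map, TensorProduct.norm_tmul,
      he, mul_one, one_mul]

theorem tendsto_sum_rankOne (b : HilbertBasis κ ℂ L) (x : L) :
    Tendsto (fun F : Finset κ => (∑ i ∈ F, rankOne ℂ (b i) (b i)) x) atTop (𝓝 x) := by
  have h : HasSum (fun i => b.repr x i • b i) x := b.hasSum_repr x
  simp only [b.repr_apply_apply] at h
  simpa [HasSum, sum_apply] using h

/-- A net of contractions that converges to the identity on the vectors `ι* (x ⊗ e)` converges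
strongly to the identity. -/
theorem tendsto_of_tendsto_leg {ι : L ≃ₗᵢ[ℂ] HilbertTensor L L} {l : Filter κ}
    {T : κ → L →L[ℂ] L} (hT : ∀ i, ‖T i‖ ≤ 1)
    (h : ∀ e x, Tendsto (fun i => T i (leg ι e x)) l (𝓝 (leg ι e x))) (x : L) :
    Tendsto (fun i => T i x) l (𝓝 x) := by
  have key : ∀ z, Tendsto (fun i => T i (ι.symm (incl L L z))) l (𝓝 (ι.symm (incl L L z))) := by
    intro z
    induction z using TensorProduct.induction_on with
    | zero => simpa using tendsto_const_nhds
    | add z w hz hw => simpa only [map_add] using hz.add hw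
    | tmul x e => exact h e x
  rw [Metric.tendsto_nhds]
  intro ε hε
  have hdense : ∃ z, ‖ι x - incl L L z‖ < ε / 3 := by
    have hx : ι x ∈ closure (Set.range (incl L L)) :=
      HilbertTensor.induction_on (ι x) isClosed_closure fun z => subset_closure ⟨z, rfl⟩
    obtain ⟨_, ⟨z, rfl⟩, hz⟩ := Metric.mem_closure_iff.1 hx (ε / 3) (by positivity)
    exact ⟨z, by rwa [← dist_eq_norm]⟩
  obtain ⟨z, hz⟩ := hdense
  set y := ι.symm (incl L L z)
  have hxy : ‖x - y‖ < ε / 3 := by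
    rw [← ι.norm_map, map_sub, ι.apply_symm_apply]
    exact hz
  filter_upwards [Metric.tendsto_nhds.1 (key z) (ε / 3) (by positivity)] with i hi
  rw [dist_eq_norm] at hi ⊢
  have h1 : ‖T i (x - y)‖ ≤ ‖x - y‖ := by
    simpa using (T i).le_of_opNorm_le (hT i) (x - y)
  have h2 : T i x - x = T i (x - y) + (T i y - y) - (x - y) := by
    rw [map_sub]
    abel
  rw [h2]
  have h3 := norm_sub_le (T i (x - y) + (T i y - y)) (x - y)
  have h4 := norm_add_le (T i (x - y)) (T i y - y)
  linarith

variable [CompleteSpace L]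

theorem star_leg_leg_apply (ι : L ≃ₗᵢ[ℂ] HilbertTensor L L) (e f x : L) :
    (star (leg ι e)) (leg ι f x) = ⟪e, f⟫_ℂ • x := by
  refine ext_inner_left ℂ fun y => ?_
  rw [ContinuousLinearMap.star_eq_adjoint, ContinuousLinearMap.adjoint_inner_right, inner_leg_leg,
    inner_smul_right, mul_comm]

theorem star_leg_mul_leg (ι : L ≃ₗᵢ[ℂ] HilbertTensor L L) (e f : L) :
    star (leg ι e) * leg ι f = ⟪e, f⟫_ℂ • 1 := by
  ext x
  exact star_leg_leg_apply ι e f x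

theorem star_leg_mul_diamond (ι : L ≃ₗᵢ[ℂ] HilbertTensor L L) (c : L →L[ℂ] L) (e : L) :
    star (leg ι e) * diamond ι c 1 = c * star (leg ι e) :=
  ext_leg ι fun f x => by
    simp [diamond_leg_apply, star_leg_leg_apply]

theorem diamond_rankOne (ι : L ≃ₗᵢ[ℂ] HilbertTensor L L) (c : L →L[ℂ] L) (e f : L) :
    diamond ι c (rankOne ℂ f e) = leg ι f * c * star (leg ι e) :=
  ext_leg ι fun g x => by
    simp only [diamond_leg_apply, mul_apply_eq_comp, star_leg_leg_apply, rankOne_apply, map_smul]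
    simp [leg_apply]

theorem star_leg_mul_leg_self (ι : L ≃ₗᵢ[ℂ] HilbertTensor L L) {b : κ → L}
    (hb : Orthonormal ℂ b) (i : κ) : star (leg ι (b i)) * leg ι (b i) = 1 := by
  rw [star_leg_mul_leg, inner_self_eq_norm_sq_to_K, hb.1 i]
  simp

theorem star_leg_mul_leg_of_ne (ι : L ≃ₗᵢ[ℂ] HilbertTensor L L) {b : κ → L}
    (hb : Orthonormal ℂ b) (i j : κ) (h : i ≠ j) : star (leg ι (b i)) * leg ι (b j) = 0 := by
  rw [star_leg_mul_leg, hb.2 h, zero_smul]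

/-- The projection of `L` onto the subspace corresponding to `L ⊗ e`, for a unit vector `e`. -/
def legProj (ι : L ≃ₗᵢ[ℂ] HilbertTensor L L) (e : L) : L →L[ℂ] L := leg ι e * star (leg ι e)

theorem isStarProjection_legProj (ι : L ≃ₗᵢ[ℂ] HilbertTensor L L) {b : κ → L}
    (hb : Orthonormal ℂ b) (i : κ) : IsStarProjection (legProj ι (b i)) := by
  refine ⟨?_, by simp [legProj, IsSelfAdjoint]⟩
  change leg ι (b i) * star (leg ι (b i)) * (leg ι (b i) * star (leg ι (b i))) = _
  rw [mul_assoc, ← mul_assoc (star _), star_leg_mul_leg_self ι hb, one_mul]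
  rfl

theorem legProj_mul_legProj_of_ne (ι : L ≃ₗᵢ[ℂ] HilbertTensor L L) {b : κ → L}
    (hb : Orthonormal ℂ b) (i j : κ) (h : i ≠ j) : legProj ι (b i) * legProj ι (b j) = 0 := by
  rw [legProj, legProj, mul_assoc, ← mul_assoc (star _), star_leg_mul_leg_of_ne ι hb i j h,
    zero_mul, mul_zero]

theorem isStarProjection_sum_rankOne {b : κ → L} (hb : Orthonormal ℂ b) (F : Finset κ) :
    IsStarProjection (∑ i ∈ F, rankOne ℂ (b i) (b i)) :=
  isStarProjection_sum (fun i => isStarProjection_rankOne_self (hb.1 i))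
    (fun i j h => by
      rw [ContinuousLinearMap.mul_def, rankOne_comp_rankOne, hb.2 h, zero_smul]) F

theorem sum_legProj_leg_apply (ι : L ≃ₗᵢ[ℂ] HilbertTensor L L) (b : κ → L) (F : Finset κ)
    (e x : L) : (∑ i ∈ F, legProj ι (b i)) (leg ι e x) =
      leg (swapped ι) x ((∑ i ∈ F, rankOne ℂ (b i) (b i)) e) := by
  simp only [sum_apply, map_sum]
  refine Finset.sum_congr rfl fun i _ => ?_
  rw [legProj, mul_apply_eq_comp, star_leg_leg_apply, rankOne_apply, map_smul, map_smul,
    leg_swapped]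

theorem isStarProjection_sum_legProj (ι : L ≃ₗᵢ[ℂ] HilbertTensor L L) {b : κ → L}
    (hb : Orthonormal ℂ b) (F : Finset κ) : IsStarProjection (∑ i ∈ F, legProj ι (b i)) :=
  isStarProjection_sum (isStarProjection_legProj ι hb) (legProj_mul_legProj_of_ne ι hb) F

theorem tendsto_sum_legProj (ι : L ≃ₗᵢ[ℂ] HilbertTensor L L) (b : HilbertBasis κ ℂ L) (x : L) :
    Tendsto (fun F : Finset κ => (∑ i ∈ F, legProj ι (b i)) x) atTop (𝓝 x) := by
  refine tendsto_of_tendsto_leg (ι := ι)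
    (fun F => (isStarProjection_sum_legProj ι b.orthonormal F).norm_le) (fun e x => ?_) x
  simp only [sum_legProj_leg_apply]
  rw [← leg_swapped]
  exact ((leg (swapped ι) x).continuous.tendsto e).comp (tendsto_sum_rankOne b e)

/-- An infinite-dimensional Hilbert space contains an orthonormal sequence. -/
theorem exists_orthonormal_nat (hL : ¬ FiniteDimensional ℂ L) : ∃ e : ℕ → L, Orthonormal ℂ e := by
  obtain ⟨w, b, hb⟩ := exists_hilbertBasis ℂ L
  have hw : Infinite w := by
    by_contra h
    rw [not_infinite_iff_finite] at h
    have := Fintype.ofFinite w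
    exact hL (Module.Basis.finiteDimensional_of_finite b.toOrthonormalBasis.toBasis)
  have f := Infinite.natEmbedding w
  exact ⟨fun n => b (f n), b.orthonormal.comp f f.injective⟩

end Legs

/-! ### Outer multiplications and quantum norms -/

section QuantumNorms

open Filter Topology InnerProductSpace

variable {L : Type*} [NormedAddCommGroup L] [InnerProductSpace ℂ L]
  {E F : Type*} [AddCommGroup E] [Module ℂ E] [AddCommGroup F] [Module ℂ F]

/-- A shortcut instance, which makes subtraction on amplifications available quickly. -/
instance : AddCommGroup (Ampl L E) := TensorProduct.addCommGroup

theorem lact_tmul (a : L →L[ℂ] L) (c : Compacts L) (x : E) :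
    lact a (c ⊗ₜ[ℂ] x) = mulLeftCompact a c ⊗ₜ x := rfl

theorem ract_tmul (a : L →L[ℂ] L) (c : Compacts L) (x : E) :
    ract a (c ⊗ₜ[ℂ] x) = mulRightCompact a c ⊗ₜ x := rfl

theorem coe_mulLeftCompact (a : L →L[ℂ] L) (c : Compacts L) :
    (mulLeftCompact a c : L →L[ℂ] L) = a * c := rfl

theorem coe_mulRightCompact (a : L →L[ℂ] L) (c : Compacts L) :
    (mulRightCompact a c : L →L[ℂ] L) = c * a := rfl

theorem coe_compactMul (a b : Compacts L) : (compactMul a b : L →L[ℂ] L) = a * b := rfl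

theorem lact_lact (a b : L →L[ℂ] L) (u : Ampl L E) : lact a (lact b u) = lact (a * b) u := by
  rw [lact, lact, ← LinearMap.rTensor_comp_apply]
  rfl

theorem ract_ract (a b : L →L[ℂ] L) (u : Ampl L E) : ract a (ract b u) = ract (b * a) u := by
  rw [ract, ract, ← LinearMap.rTensor_comp_apply]
  rfl

theorem lact_ract (a b : L →L[ℂ] L) (u : Ampl L E) : lact a (ract b u) = ract b (lact a u) := by
  rw [lact, ract, ← LinearMap.rTensor_comp_apply, ← LinearMap.rTensor_comp_apply]
  rfl

theorem lact_add (a b : L →L[ℂ] L) (u : Ampl L E) : lact (a + b) u = lact a u + lact b u := by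
  rw [lact, lact, lact, ← LinearMap.add_apply, ← LinearMap.rTensor_add]
  rfl

theorem ract_add (a b : L →L[ℂ] L) (u : Ampl L E) : ract (a + b) u = ract a u + ract b u := by
  have h : mulRightCompact (a + b) = mulRightCompact a + mulRightCompact b := by
    ext1 c
    exact Subtype.ext (mul_add (c : L →L[ℂ] L) a b)
  rw [ract, ract, ract, ← LinearMap.add_apply, ← LinearMap.rTensor_add, h]

theorem lact_one (u : Ampl L E) : lact 1 u = u := LinearMap.rTensor_id_apply _ _ u

theorem ract_one (u : Ampl L E) : ract 1 u = u := LinearMap.rTensor_id_apply _ _ u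

theorem lact_zero (u : Ampl L E) : lact 0 u = 0 := by
  simpa only [add_zero, left_eq_add] using lact_add 0 0 u

theorem ract_zero (u : Ampl L E) : ract 0 u = 0 := by
  simpa only [add_zero, left_eq_add] using ract_add 0 0 u

theorem diamond_add_left (ι : L ≃ₗᵢ[ℂ] HilbertTensor L L) (c c' d : L →L[ℂ] L) :
    diamond ι (c + c') d = diamond ι c d + diamond ι c' d := by
  ext x
  simp [diamond_apply, hilbertMap_add_left]

theorem diamond_smul_left (ι : L ≃ₗᵢ[ℂ] HilbertTensor L L) (r : ℂ) (c d : L →L[ℂ] L) :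
    diamond ι (r • c) d = r • diamond ι c d := by
  ext x
  simp [diamond_apply, hilbertMap_smul_left]

/-- The operation `c ↦ a (c ◇ 1)` on compact operators. -/
def mulDiamondOne (ι : L ≃ₗᵢ[ℂ] HilbertTensor L L) (a : Compacts L) : Compacts L →ₗ[ℂ]
    Compacts L where
  toFun c := mulRightCompact (diamond ι c 1) a
  map_add' c d := Subtype.ext (by simp [coe_mulRightCompact, diamond_add_left, mul_add])
  map_smul' r c := Subtype.ext (by simp [coe_mulRightCompact, diamond_smul_left])

/-- The operation `c ↦ (c ◇ 1) a` on compact operators. -/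
def diamondOneMul (ι : L ≃ₗᵢ[ℂ] HilbertTensor L L) (a : Compacts L) : Compacts L →ₗ[ℂ]
    Compacts L where
  toFun c := mulLeftCompact (diamond ι c 1) a
  map_add' c d := Subtype.ext (by simp [coe_mulLeftCompact, diamond_add_left, add_mul])
  map_smul' r c := Subtype.ext (by simp [coe_mulLeftCompact, diamond_smul_left])

theorem coe_mulDiamondOne (ι : L ≃ₗᵢ[ℂ] HilbertTensor L L) (a c : Compacts L) :
    (mulDiamondOne ι a c : L →L[ℂ] L) = a * diamond ι c 1 := rfl

theorem coe_diamondOneMul (ι : L ≃ₗᵢ[ℂ] HilbertTensor L L) (a c : Compacts L) :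
    (diamondOneMul ι a c : L →L[ℂ] L) = diamond ι c 1 * a := rfl

/-- The operation `u ↦ a · (u ◇ 1)` on an amplification. The factor `u ◇ 1` alone is not in the
amplification, as `c ◇ 1` is not compact. -/
def lactDiamondOne (ι : L ≃ₗᵢ[ℂ] HilbertTensor L L) (a : Compacts L) : Ampl L E →ₗ[ℂ] Ampl L E :=
  (mulDiamondOne ι a).rTensor E

/-- The operation `u ↦ (u ◇ 1) · a` on an amplification. -/
def ractDiamondOne (ι : L ≃ₗᵢ[ℂ] HilbertTensor L L) (a : Compacts L) : Ampl L E →ₗ[ℂ] Ampl L E :=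
  (diamondOneMul ι a).rTensor E

namespace IsQuantumNorm

variable [CompleteSpace L] {ν : Ampl L E → ℝ}

theorem map_zero (hν : IsQuantumNorm ν) : ν 0 = 0 := by
  simpa using hν.smul_eq 0 0

theorem map_neg (hν : IsQuantumNorm ν) (u : Ampl L E) : ν (-u) = ν u := by
  simpa only [neg_smul, one_smul, norm_neg, norm_one, one_mul] using hν.smul_eq (-1) u

theorem nonneg (hν : IsQuantumNorm ν) (u : Ampl L E) : 0 ≤ ν u := by
  have h := hν.add_le u (-u)
  rw [add_neg_cancel, hν.map_zero, hν.map_neg] at h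
  linarith

end IsQuantumNorm

variable [CompleteSpace L] {κ : Type*}

/-- The operation `u ↦ u ◇ p`, where `p` is the projection onto the span of the orthonormal vectors
`b i`, `i ∈ s`. It is encoded as the sum of the copies of `u` that the isometries `leg ι (b i)`
produce. -/
def copies (ι : L ≃ₗᵢ[ℂ] HilbertTensor L L) (b : κ → L) (s : Finset κ) :
    Ampl L E →ₗ[ℂ] Ampl L E :=
  ∑ i ∈ s, lact (leg ι (b i)) ∘ₗ ract (star (leg ι (b i)))

theorem copies_apply (ι : L ≃ₗᵢ[ℂ] HilbertTensor L L) (b : κ → L) (s : Finset κ) (u : Ampl L E) :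
    copies ι b s u = ∑ i ∈ s, lact (leg ι (b i)) (ract (star (leg ι (b i))) u) := by
  simp [copies]

theorem isSupport_copy (ι : L ≃ₗᵢ[ℂ] HilbertTensor L L) {b : κ → L} (hb : Orthonormal ℂ b) (i : κ)
    (u : Ampl L E) :
    IsSupport (legProj ι (b i)) (lact (leg ι (b i)) (ract (star (leg ι (b i))) u)) where
  isStarProjection := isStarProjection_legProj ι hb i
  left := by
    rw [lact_lact, legProj, mul_assoc, star_leg_mul_leg_self ι hb, mul_one]
  right := by
    rw [← lact_ract, ract_ract, legProj, ← mul_assoc, star_leg_mul_leg_self ι hb, one_mul]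

/-- Orthogonal supports add up. -/
theorem IsSupport.add {P Q : L →L[ℂ] L} {u v : Ampl L E} (hu : IsSupport P u) (hv : IsSupport Q v)
    (h : P * Q = 0) : IsSupport (P + Q) (u + v) := by
  have h' : Q * P = 0 := by
    simpa [hu.isStarProjection.isSelfAdjoint.star_eq, hv.isStarProjection.isSelfAdjoint.star_eq]
      using congr(star $h)
  refine ⟨hu.isStarProjection.add hv.isStarProjection h, ?_, ?_⟩
  · have h1 : lact P v = 0 := by rw [← hv.left, lact_lact, h, lact_zero]
    have h2 : lact Q u = 0 := by rw [← hu.left, lact_lact, h', lact_zero]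
    rw [map_add, lact_add, lact_add, hu.left, hv.left, h1, h2, add_zero, zero_add]
  · have h1 : ract P v = 0 := by rw [← hv.right, ract_ract, h', ract_zero]
    have h2 : ract Q u = 0 := by rw [← hu.right, ract_ract, h, ract_zero]
    rw [map_add, ract_add, ract_add, hu.right, hv.right, h1, h2, add_zero, zero_add]

theorem isSupport_copies (ι : L ≃ₗᵢ[ℂ] HilbertTensor L L) {b : κ → L} (hb : Orthonormal ℂ b)
    (s : Finset κ) (u : Ampl L E) : IsSupport (∑ i ∈ s, legProj ι (b i)) (copies ι b s u) := by
  classical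
  rw [copies_apply]
  induction s using Finset.induction_on with
  | empty => exact ⟨by simp, by simp, by simp⟩
  | insert i s hi ih =>
    rw [Finset.sum_insert hi, Finset.sum_insert hi]
    refine (isSupport_copy ι hb i u).add ih ?_
    rw [Finset.mul_sum]
    exact Finset.sum_eq_zero fun j hj =>
      legProj_mul_legProj_of_ne ι hb i j (ne_of_mem_of_not_mem hj hi).symm

/-- An orthogonal sum of copies of `u` has norm at most the norm of `u`, by the second axiom of
Ruan. -/
theorem IsQuantumNorm.copies_le {ν : Ampl L E → ℝ} (hν : IsQuantumNorm ν)
    (ι : L ≃ₗᵢ[ℂ] HilbertTensor L L) {b : κ → L} (hb : Orthonormal ℂ b) (s : Finset κ)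
    (u : Ampl L E) : ν (copies ι b s u) ≤ ν u := by
  classical
  induction s using Finset.induction_on with
  | empty => simpa [copies, hν.map_zero] using hν.nonneg u
  | insert i s hi ih =>
    have hs := isSupport_copies ι hb s u
    rw [copies_apply, Finset.sum_insert hi, ← copies_apply,
      hν.support_max _ _ _ _ (isSupport_copy ι hb i u) hs]
    · refine max_le ?_ ih
      have h1 := norm_leg ι (hb.1 i)
      have h2 : ‖star (leg ι (b i))‖ ≤ 1 := by rwa [norm_star]
      calc _ ≤ ‖leg ι (b i)‖ * (‖star (leg ι (b i))‖ * ν u) :=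
            (hν.lact_le _ _).trans (mul_le_mul_of_nonneg_left (hν.ract_le _ _) (norm_nonneg _))
        _ ≤ 1 * (1 * ν u) := by
            have := hν.nonneg u
            gcongr
        _ = ν u := by ring
    · rw [Finset.mul_sum]
      exact Finset.sum_eq_zero fun j hj =>
        legProj_mul_legProj_of_ne ι hb i j (ne_of_mem_of_not_mem hj hi).symm

/-- Every compact operator is a product of two compact operators. -/
theorem exists_compactMul (hL : ¬ FiniteDimensional ℂ L) (ι : L ≃ₗᵢ[ℂ] HilbertTensor L L)
    (c : Compacts L) : ∃ d g : Compacts L, compactMul d g = c := by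
  obtain ⟨e, he⟩ := exists_orthonormal_nat hL
  obtain ⟨d, g, hd, hg, h⟩ := IsCompactOperator.exists_mul (c := (c : L →L[ℂ] L))
    (star_leg_mul_leg_self ι he) (star_leg_mul_leg_of_ne ι he) c.2
  exact ⟨⟨d, hd⟩, ⟨g, hg⟩, Subtype.ext h⟩

theorem copies_tmul (ι : L ≃ₗᵢ[ℂ] HilbertTensor L L) (b : κ → L) (s : Finset κ) (c : Compacts L)
    (x : E) : copies ι b s (c ⊗ₜ[ℂ] x) =
      (∑ i ∈ s, mulLeftCompact (leg ι (b i)) (mulRightCompact (star (leg ι (b i))) c)) ⊗ₜ x := by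
  rw [copies_apply, TensorProduct.sum_tmul]
  rfl

/-- The norm of `a · (u ◇ (1 - p))` tends to zero when `p` runs over the projections onto the
spans of finite sets of basis vectors. For `u = c ⊗ x` and `a = a₁ a₂` this element equals
`(a₁ ⊗ x) · a₂ (1 ◇ (1 - p)) (c ◇ 1)`, where the compact operator `a₂` makes the right factor
small. -/
theorem IsQuantumNorm.tendsto_lactDiamondOne_sub {ν : Ampl L E → ℝ} (hν : IsQuantumNorm ν)
    (hL : ¬ FiniteDimensional ℂ L) (ι : L ≃ₗᵢ[ℂ] HilbertTensor L L) (a : Compacts L)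
    (b : HilbertBasis κ ℂ L) (u : Ampl L E) :
    Tendsto (fun s => ν (lactDiamondOne ι a u - lact (a : L →L[ℂ] L) (copies ι b s u))) atTop
      (𝓝 0) := by
  have hp := isStarProjection_sum_legProj ι b.orthonormal
  induction u using TensorProduct.induction_on with
  | zero => simp [hν.map_zero]
  | add u v hu hv =>
    refine squeeze_zero (fun s => hν.nonneg _) (fun s => ?_) (by simpa using hu.add hv)
    simp only [map_add]
    rw [add_sub_add_comm]
    exact hν.add_le _ _
  | tmul c x =>
    obtain ⟨a₁, a₂, rfl⟩ := exists_compactMul hL ι a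
    have h := tendsto_norm_compact_mul (l := atTop)
      (T := fun s => 1 - ∑ i ∈ s, legProj ι (b i)) (fun s => (hp s).one_sub.norm_le)
      (fun s => (hp s).one_sub.isSelfAdjoint.star_eq)
      (fun y => by simpa using (tendsto_sum_legProj ι b y).const_sub y) a₂.2
    have hbound := (h.mul_const ‖diamond ι (c : L →L[ℂ] L) 1‖).mul_const (ν (a₁ ⊗ₜ x))
    rw [zero_mul, zero_mul] at hbound
    refine squeeze_zero (fun s => hν.nonneg _) (fun s => ?_) hbound
    have key : lactDiamondOne ι (compactMul a₁ a₂) (c ⊗ₜ[ℂ] x) -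
        lact ((compactMul a₁ a₂ : Compacts L) : L →L[ℂ] L) (copies ι b s (c ⊗ₜ x)) =
          ract ((a₂ : L →L[ℂ] L) * (1 - ∑ i ∈ s, legProj ι (b i)) *
            diamond ι (c : L →L[ℂ] L) 1) (a₁ ⊗ₜ x) := by
      rw [lactDiamondOne, LinearMap.rTensor_tmul, copies_tmul, lact_tmul, ract_tmul]
      refine (TensorProduct.sub_tmul _ _ _).symm.trans (congrArg (· ⊗ₜ[ℂ] x) (Subtype.ext ?_))
      have h2 : ((∑ i ∈ s, mulLeftCompact (leg ι (b i)) (mulRightCompact (star (leg ι (b i))) c) :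
          Compacts L) : L →L[ℂ] L) = (∑ i ∈ s, legProj ι (b i)) * diamond ι (c : L →L[ℂ] L) 1 := by
        rw [Submodule.coe_sum, Finset.sum_mul]
        refine Finset.sum_congr rfl fun i _ => ?_
        rw [coe_mulLeftCompact, coe_mulRightCompact, legProj, mul_assoc, star_leg_mul_diamond]
      rw [Submodule.coe_sub, coe_mulLeftCompact, h2, coe_mulRightCompact, coe_mulDiamondOne,
        coe_compactMul]
      noncomm_ring
    rw [key]
    exact (hν.ract_le _ _).trans
      (mul_le_mul_of_nonneg_right (norm_mul_le _ _) (hν.nonneg _))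

/-- The mirror image of `IsQuantumNorm.tendsto_lactDiamondOne_sub`: for `u = c ⊗ x` and `a = a₁ a₂`
the element equals `(c ◇ 1) (1 ◇ (1 - p)) a₁ · (a₂ ⊗ x)`. -/
theorem IsQuantumNorm.tendsto_ractDiamondOne_sub {ν : Ampl L E → ℝ} (hν : IsQuantumNorm ν)
    (hL : ¬ FiniteDimensional ℂ L) (ι : L ≃ₗᵢ[ℂ] HilbertTensor L L) (a : Compacts L)
    (b : HilbertBasis κ ℂ L) (u : Ampl L E) :
    Tendsto (fun s => ν (ractDiamondOne ι a u - ract (a : L →L[ℂ] L) (copies ι b s u))) atTop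
      (𝓝 0) := by
  have hp := isStarProjection_sum_legProj ι b.orthonormal
  induction u using TensorProduct.induction_on with
  | zero => simp [hν.map_zero]
  | add u v hu hv =>
    refine squeeze_zero (fun s => hν.nonneg _) (fun s => ?_) (by simpa using hu.add hv)
    simp only [map_add]
    rw [add_sub_add_comm]
    exact hν.add_le _ _
  | tmul c x =>
    obtain ⟨a₁, a₂, rfl⟩ := exists_compactMul hL ι a
    have h := tendsto_norm_mul_compact (l := atTop)
      (T := fun s => 1 - ∑ i ∈ s, legProj ι (b i)) (fun s => (hp s).one_sub.norm_le)
      (fun y => by simpa using (tendsto_sum_legProj ι b y).const_sub y) a₁.2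
    have hbound := (h.const_mul ‖diamond ι (c : L →L[ℂ] L) 1‖).mul_const (ν (a₂ ⊗ₜ x))
    rw [mul_zero, zero_mul] at hbound
    refine squeeze_zero (fun s => hν.nonneg _) (fun s => ?_) hbound
    have key : ractDiamondOne ι (compactMul a₁ a₂) (c ⊗ₜ[ℂ] x) -
        ract ((compactMul a₁ a₂ : Compacts L) : L →L[ℂ] L) (copies ι b s (c ⊗ₜ x)) =
          lact (diamond ι (c : L →L[ℂ] L) 1 * ((1 - ∑ i ∈ s, legProj ι (b i)) *
            (a₁ : L →L[ℂ] L))) (a₂ ⊗ₜ x) := by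
      rw [ractDiamondOne, LinearMap.rTensor_tmul, copies_tmul, ract_tmul, lact_tmul]
      refine (TensorProduct.sub_tmul _ _ _).symm.trans (congrArg (· ⊗ₜ[ℂ] x) (Subtype.ext ?_))
      have h2 : ((∑ i ∈ s, mulLeftCompact (leg ι (b i)) (mulRightCompact (star (leg ι (b i))) c) :
          Compacts L) : L →L[ℂ] L) = diamond ι (c : L →L[ℂ] L) 1 * (∑ i ∈ s, legProj ι (b i)) := by
        rw [Submodule.coe_sum, Finset.mul_sum]
        refine Finset.sum_congr rfl fun i _ => ?_
        rw [coe_mulLeftCompact, coe_mulRightCompact, legProj, ← mul_assoc, ← mul_assoc,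
          diamond_mul_leg]
        rfl
      rw [Submodule.coe_sub, coe_mulRightCompact, h2, coe_mulLeftCompact, coe_diamondOneMul,
        coe_compactMul]
      noncomm_ring
    rw [key]
    exact (hν.lact_le _ _).trans
      (mul_le_mul_of_nonneg_right (norm_mul_le _ _) (hν.nonneg _))

/-- Amplification does not increase the norm: `‖a · (u ◇ 1)‖ ≤ ‖a‖ ‖u‖`. -/
theorem IsQuantumNorm.lactDiamondOne_le {ν : Ampl L E → ℝ} (hν : IsQuantumNorm ν)
    (hL : ¬ FiniteDimensional ℂ L) (ι : L ≃ₗᵢ[ℂ] HilbertTensor L L) (a : Compacts L)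
    (u : Ampl L E) : ν (lactDiamondOne ι a u) ≤ ‖a‖ * ν u := by
  obtain ⟨w, b, -⟩ := exists_hilbertBasis ℂ L
  have h := (hν.tendsto_lactDiamondOne_sub hL ι a b u).const_add (‖a‖ * ν u)
  rw [add_zero] at h
  refine ge_of_tendsto' h fun s => ?_
  have h1 := hν.add_le (lact (a : L →L[ℂ] L) (copies ι b s u))
    (lactDiamondOne ι a u - lact (a : L →L[ℂ] L) (copies ι b s u))
  rw [add_sub_cancel] at h1
  refine h1.trans (add_le_add_left ((hν.lact_le _ _).trans ?_) _)
  exact mul_le_mul_of_nonneg_left (hν.copies_le ι b.orthonormal s u) (norm_nonneg _)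

/-- Amplification does not increase the norm: `‖(u ◇ 1) · a‖ ≤ ‖u‖ ‖a‖`. -/
theorem IsQuantumNorm.ractDiamondOne_le {ν : Ampl L E → ℝ} (hν : IsQuantumNorm ν)
    (hL : ¬ FiniteDimensional ℂ L) (ι : L ≃ₗᵢ[ℂ] HilbertTensor L L) (a : Compacts L)
    (u : Ampl L E) : ν (ractDiamondOne ι a u) ≤ ‖a‖ * ν u := by
  obtain ⟨w, b, -⟩ := exists_hilbertBasis ℂ L
  have h := (hν.tendsto_ractDiamondOne_sub hL ι a b u).const_add (‖a‖ * ν u)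
  rw [add_zero] at h
  refine ge_of_tendsto' h fun s => ?_
  have h1 := hν.add_le (ract (a : L →L[ℂ] L) (copies ι b s u))
    (ractDiamondOne ι a u - ract (a : L →L[ℂ] L) (copies ι b s u))
  rw [add_sub_cancel] at h1
  refine h1.trans (add_le_add_left ((hν.ract_le _ _).trans ?_) _)
  exact mul_le_mul_of_nonneg_left (hν.copies_le ι b.orthonormal s u) (norm_nonneg _)

/-- The identity `a · (u ◇ v) · b = (a · (u ◇ 1)) ⊙ ((1 ◇ v) · b)`. -/
theorem lact_ract_diamondTensor (ι : L ≃ₗᵢ[ℂ] HilbertTensor L L) (a b : Compacts L) (u : Ampl L E)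
    (v : Ampl L F) : lact (a : L →L[ℂ] L) (ract (b : L →L[ℂ] L) (diamondTensor ι u v)) =
      effros (lactDiamondOne ι a u) (ractDiamondOne (swapped ι) b v) := by
  have hl : ∀ (u u' : Ampl L E) (v : Ampl L F), diamondTensor ι (u + u') v =
      diamondTensor ι u v + diamondTensor ι u' v := fun u u' v => by simp [diamondTensor]
  have hr : ∀ (u : Ampl L E) (v v' : Ampl L F), diamondTensor ι u (v + v') =
      diamondTensor ι u v + diamondTensor ι u v' := fun u v v' => by simp [diamondTensor]
  induction u using TensorProduct.induction_on with
  | zero => simp [diamondTensor, effros]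
  | add u u' hu hu' =>
    simp only [hl, map_add, hu, hu']
    simp [effros]
  | tmul c x =>
    induction v using TensorProduct.induction_on with
    | zero => simp [diamondTensor, effros]
    | add v v' hv hv' =>
      simp only [hr, map_add, hv, hv']
      simp [effros]
    | tmul d y =>
      refine congrArg (· ⊗ₜ[ℂ] (x ⊗ₜ[ℂ] y)) (Subtype.ext ?_)
      change (a : L →L[ℂ] L) * (diamond ι (c : L →L[ℂ] L) d * b) =
        (a * diamond ι c 1) * (diamond (swapped ι) d 1 * b)
      have h := diamond_mul_diamond ι (c : L →L[ℂ] L) 1 1 (d : L →L[ℂ] L)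
      rw [mul_one, one_mul] at h
      rw [diamond_swapped, ← h]
      noncomm_ring

end QuantumNorms

/-! ### Factorization of elements of an amplification -/

section Factorization

open Filter Topology InnerProductSpace

variable {L : Type*} [NormedAddCommGroup L] [InnerProductSpace ℂ L]
  {E F : Type*} [AddCommGroup E] [Module ℂ E] [AddCommGroup F] [Module ℂ F]

theorem isCompactOperator_rankOne (e f : L) : IsCompactOperator (rankOne ℂ e f) :=
  isCompactOperator_of_factor (ContinuousLinearMap.toSpanSingleton ℂ e) (innerSL ℂ f)

/-- The rank-one operator `x ↦ ⟨f, x⟩ e` as a compact operator. -/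
def compactRankOne (e f : L) : Compacts L := ⟨rankOne ℂ e f, isCompactOperator_rankOne e f⟩

theorem coe_compactRankOne (e f : L) : (compactRankOne e f : L →L[ℂ] L) = rankOne ℂ e f := rfl

/-- The projection onto the span of finitely many orthonormal vectors, as a compact operator. -/
def compactProj {κ : Type*} (b : κ → L) (s : Finset κ) : Compacts L :=
  ∑ i ∈ s, compactRankOne (b i) (b i)

theorem coe_compactProj {κ : Type*} (b : κ → L) (s : Finset κ) :
    (compactProj b s : L →L[ℂ] L) = ∑ i ∈ s, rankOne ℂ (b i) (b i) := by
  rw [compactProj, Submodule.coe_sum]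
  rfl

variable [CompleteSpace L]

theorem exists_sum_lact (hL : ¬ FiniteDimensional ℂ L) (ι : L ≃ₗᵢ[ℂ] HilbertTensor L L)
    (u : Ampl L E) : ∃ (n : ℕ) (d : Fin n → Compacts L) (w : Fin n → Ampl L E),
      u = ∑ k, lact (d k : L →L[ℂ] L) (w k) := by
  induction u using TensorProduct.induction_on with
  | zero => exact ⟨0, Fin.elim0, Fin.elim0, by simp⟩
  | add u v hu hv =>
    obtain ⟨n, d, w, rfl⟩ := hu
    obtain ⟨m, d', w', rfl⟩ := hv
    exact ⟨n + m, Fin.append d d', Fin.append w w', by simp [Fin.sum_univ_add]⟩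
  | tmul c x =>
    obtain ⟨d, g, rfl⟩ := exists_compactMul hL ι c
    exact ⟨1, fun _ => d, fun _ => g ⊗ₜ x, by
      rw [Fin.sum_univ_one, lact_tmul]
      rfl⟩

theorem exists_sum_ract (hL : ¬ FiniteDimensional ℂ L) (ι : L ≃ₗᵢ[ℂ] HilbertTensor L L)
    (u : Ampl L E) : ∃ (n : ℕ) (d : Fin n → Compacts L) (w : Fin n → Ampl L E),
      u = ∑ k, ract (d k : L →L[ℂ] L) (w k) := by
  induction u using TensorProduct.induction_on with
  | zero => exact ⟨0, Fin.elim0, Fin.elim0, by simp⟩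
  | add u v hu hv =>
    obtain ⟨n, d, w, rfl⟩ := hu
    obtain ⟨m, d', w', rfl⟩ := hv
    exact ⟨n + m, Fin.append d d', Fin.append w w', by simp [Fin.sum_univ_add]⟩
  | tmul c x =>
    obtain ⟨d, g, rfl⟩ := exists_compactMul hL ι c
    exact ⟨1, fun _ => g, fun _ => d ⊗ₜ x, by
      rw [Fin.sum_univ_one, ract_tmul]
      rfl⟩

/-- Every `u` is a sum of products `d · w` with compact `d` at almost no cost in norm: up to a sum
of small terms, `u` is `p · u` for a projection `p` of finite rank. -/
theorem IsQuantumNorm.exists_sum_lact_le {ν : Ampl L E → ℝ} (hν : IsQuantumNorm ν)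
    (hL : ¬ FiniteDimensional ℂ L) (ι : L ≃ₗᵢ[ℂ] HilbertTensor L L) (u : Ampl L E) {ε : ℝ}
    (hε : 0 < ε) : ∃ (n : ℕ) (d : Fin n → Compacts L) (w : Fin n → Ampl L E),
      u = ∑ k, lact (d k : L →L[ℂ] L) (w k) ∧ ∑ k, ‖d k‖ * ν (w k) ≤ ν u + ε := by
  obtain ⟨n, d, w, hu⟩ := exists_sum_lact hL ι u
  obtain ⟨κ, b, -⟩ := exists_hilbertBasis ℂ L
  have hp := isStarProjection_sum_rankOne b.orthonormal
  have hlim : Tendsto (fun s : Finset κ => ∑ k, ‖(1 - ∑ i ∈ s, rankOne ℂ (b i) (b i)) *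
      (d k : L →L[ℂ] L)‖ * ν (w k)) atTop (𝓝 (∑ k, 0 * ν (w k))) :=
    tendsto_finsetSum _ fun k _ => (tendsto_norm_mul_compact (fun s => (hp s).one_sub.norm_le)
      (fun y => by simpa using (tendsto_sum_rankOne b y).const_sub y) (d k).2).mul_const _
  simp only [zero_mul, Finset.sum_const_zero] at hlim
  -- The factor `p` carries the norm of `u`; the terms of `(1 - p) · u` together cost less than `ε`.
  obtain ⟨s, hs⟩ := (hlim.eventually_lt_const hε).exists
  refine ⟨n + 1, Fin.cons (compactProj b s)
    fun k => mulLeftCompact (1 - ∑ i ∈ s, rankOne ℂ (b i) (b i)) (d k), Fin.cons u w, ?_, ?_⟩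
  · simp only [Fin.sum_univ_succ, Fin.cons_zero, Fin.cons_succ, coe_compactProj,
      coe_mulLeftCompact, ← lact_lact, ← map_sum, ← hu]
    rw [← lact_add, add_sub_cancel, lact_one]
  · simp only [Fin.sum_univ_succ, Fin.cons_zero, Fin.cons_succ]
    refine add_le_add (mul_le_of_le_one_left (hν.nonneg u) ?_) hs.le
    rw [← Submodule.norm_coe, coe_compactProj]
    exact (hp s).norm_le

/-- The version of `IsQuantumNorm.exists_sum_lact_le` for products `w · d`. -/
theorem IsQuantumNorm.exists_sum_ract_le {ν : Ampl L E → ℝ} (hν : IsQuantumNorm ν)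
    (hL : ¬ FiniteDimensional ℂ L) (ι : L ≃ₗᵢ[ℂ] HilbertTensor L L) (u : Ampl L E) {ε : ℝ}
    (hε : 0 < ε) : ∃ (n : ℕ) (d : Fin n → Compacts L) (w : Fin n → Ampl L E),
      u = ∑ k, ract (d k : L →L[ℂ] L) (w k) ∧ ∑ k, ‖d k‖ * ν (w k) ≤ ν u + ε := by
  obtain ⟨n, d, w, hu⟩ := exists_sum_ract hL ι u
  obtain ⟨κ, b, -⟩ := exists_hilbertBasis ℂ L
  have hp := isStarProjection_sum_rankOne b.orthonormal
  have hlim : Tendsto (fun s : Finset κ => ∑ k, ‖(d k : L →L[ℂ] L) *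
      (1 - ∑ i ∈ s, rankOne ℂ (b i) (b i))‖ * ν (w k)) atTop (𝓝 (∑ k, 0 * ν (w k))) :=
    tendsto_finsetSum _ fun k _ => (tendsto_norm_compact_mul (fun s => (hp s).one_sub.norm_le)
      (fun s => (hp s).one_sub.isSelfAdjoint.star_eq)
      (fun y => by simpa using (tendsto_sum_rankOne b y).const_sub y) (d k).2).mul_const _
  simp only [zero_mul, Finset.sum_const_zero] at hlim
  obtain ⟨s, hs⟩ := (hlim.eventually_lt_const hε).exists
  refine ⟨n + 1, Fin.cons (compactProj b s)
    fun k => mulRightCompact (1 - ∑ i ∈ s, rankOne ℂ (b i) (b i)) (d k), Fin.cons u w, ?_, ?_⟩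
  · simp only [Fin.sum_univ_succ, Fin.cons_zero, Fin.cons_succ, coe_compactProj,
      coe_mulRightCompact, ← ract_ract, ← map_sum, ← hu]
    rw [← ract_add, add_sub_cancel, ract_one]
  · simp only [Fin.sum_univ_succ, Fin.cons_zero, Fin.cons_succ]
    refine add_le_add (mul_le_of_le_one_left (hν.nonneg u) ?_) hs.le
    rw [← Submodule.norm_coe, coe_compactProj]
    exact (hp s).norm_le

end Factorization

/-! ### Column and row Hilbertians -/

section ColumnRow

open InnerProductSpace

variable {L : Type*} [NormedAddCommGroup L] [InnerProductSpace ℂ L]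
  {H : Type*} [NormedAddCommGroup H] [InnerProductSpace ℂ H]
  {E : Type*} [AddCommGroup E] [Module ℂ E]

/-- Every element of the amplification of a Hilbert space is supported on finitely many orthonormal
vectors. -/
theorem exists_sum_tmul_orthonormal (v : Ampl L H) :
    ∃ (n : ℕ) (y : Fin n → H) (c : Fin n → Compacts L), Orthonormal ℂ y ∧
      v = ∑ j, c j ⊗ₜ y j := by
  obtain ⟨n, x, c, rfl⟩ : ∃ (n : ℕ) (x : Fin n → H) (c : Fin n → Compacts L),
      v = ∑ j, c j ⊗ₜ[ℂ] x j := by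
    induction v using TensorProduct.induction_on with
    | zero => exact ⟨0, Fin.elim0, Fin.elim0, by simp⟩
    | add u v hu hv =>
      obtain ⟨n, d, w, rfl⟩ := hu
      obtain ⟨m, d', w', rfl⟩ := hv
      exact ⟨n + m, Fin.append d d', Fin.append w w', by simp [Fin.sum_univ_add]⟩
    | tmul c x => exact ⟨1, fun _ => x, fun _ => c, by simp⟩
  let V := Submodule.span ℂ (Set.range x)
  have : FiniteDimensional ℂ V := FiniteDimensional.span_of_finite ℂ (Set.finite_range x)
  let b := stdOrthonormalBasis ℂ V
  have hx : ∀ i, x i = ∑ j, ⟪(b j : H), x i⟫_ℂ • (b j : H) := fun i => by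
    have h := b.sum_repr' (⟨x i, Submodule.subset_span ⟨i, rfl⟩⟩ : V)
    have h' := congrArg (Subtype.val : V → H) h
    simpa using h'.symm
  refine ⟨_, fun j => (b j : H), fun j => ∑ i, ⟪(b j : H), x i⟫_ℂ • c i,
    b.orthonormal.comp_linearIsometry V.subtypeₗᵢ, ?_⟩
  simp only [TensorProduct.sum_tmul, TensorProduct.smul_tmul]
  rw [Finset.sum_comm]
  refine Finset.sum_congr rfl fun i _ => ?_
  rw [← TensorProduct.tmul_sum, ← hx]

theorem norm_sum_incl_tmul_sq {n : ℕ} {y : Fin n → H} (hy : Orthonormal ℂ y) (ξ : Fin n → L) :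
    ‖∑ j, incl L H (ξ j ⊗ₜ y j)‖ ^ 2 = ∑ j, ‖ξ j‖ ^ 2 := by
  have h : ((‖∑ j, incl L H (ξ j ⊗ₜ y j)‖ ^ 2 : ℝ) : ℂ) = ((∑ j, ‖ξ j‖ ^ 2 : ℝ) : ℂ) := by
    push_cast
    have h1 := inner_self_eq_norm_sq_to_K (𝕜 := ℂ) (∑ j, incl L H (ξ j ⊗ₜ y j))
    refine h1.symm.trans ?_
    simp only [sum_inner, inner_sum, LinearIsometry.inner_map_map, TensorProduct.inner_tmul,
      orthonormal_iff_ite.1 hy]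
    simp [inner_self_eq_norm_sq_to_K]
  exact_mod_cast h

/-- Sums of elementary tensors along two orthonormal systems, with the same coefficient vectors,
have the same norm. -/
theorem norm_sum_incl_tmul_eq {K : Type*} [NormedAddCommGroup K] [InnerProductSpace ℂ K] {n : ℕ}
    {y : Fin n → H} (hy : Orthonormal ℂ y) {z : Fin n → K} (hz : Orthonormal ℂ z)
    (ξ : Fin n → L) : ‖∑ j, incl L H (ξ j ⊗ₜ y j)‖ = ‖∑ j, incl L K (ξ j ⊗ₜ z j)‖ := by
  rw [← sq_eq_sq₀ (norm_nonneg _) (norm_nonneg _), norm_sum_incl_tmul_sq hy,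
    norm_sum_incl_tmul_sq hz]

theorem concreteMap_columnEmbedding {n : ℕ} (c : Fin n → Compacts L) (y : Fin n → H) (ξ : L) :
    concreteMap (columnEmbedding H) (∑ j, c j ⊗ₜ y j) (incl L ℂ (ξ ⊗ₜ 1)) =
      ∑ j, incl L H ((c j : L →L[ℂ] L) ξ ⊗ₜ y j) := by
  rw [map_sum, sum_apply]
  refine Finset.sum_congr rfl fun j _ => ?_
  rw [concreteMap_tmul, hilbertMap_incl, TensorProduct.mapL_tmul, columnEmbedding_apply, one_smul]

theorem concreteMap_rowEmbedding {n : ℕ} (c : Fin n → Compacts L) (y : Fin n → H) (ξ : L)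
    (h : ConjSpace H) :
    concreteMap (rowEmbedding H) (∑ j, c j ⊗ₜ y j) (incl L (ConjSpace H) (ξ ⊗ₜ h)) =
      ∑ j, incl L ℂ ((c j : L →L[ℂ] L) ξ ⊗ₜ ⟪h.val, y j⟫_ℂ) := by
  rw [map_sum, sum_apply]
  refine Finset.sum_congr rfl fun j _ => ?_
  rw [concreteMap_tmul, hilbertMap_incl, TensorProduct.mapL_tmul, rowEmbedding_apply]

theorem orthonormal_conjSpace {n : ℕ} {y : Fin n → H} (hy : Orthonormal ℂ y) :
    Orthonormal ℂ fun j => ConjSpace.mk (y j) :=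
  ⟨fun j => hy.1 j, fun _ _ h => hy.2 h.symm⟩

/-- The matrix units of a row form an element of norm at most one of the amplification of a column
space. -/
theorem columnNorm_rankOne_le {n : ℕ} {y : Fin n → H} (hy : Orthonormal ℂ y) {e : Fin n → L}
    (he : Orthonormal ℂ e) {f : L} (hf : ‖f‖ = 1) :
    columnNorm L H (∑ j, compactRankOne f (e j) ⊗ₜ y j) ≤ 1 := by
  refine ContinuousLinearMap.opNorm_le_bound _ zero_le_one fun z => ?_
  rw [one_mul]
  refine HilbertTensor.induction_on (p := fun z => ‖concreteMap (columnEmbedding H)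
    (∑ j, compactRankOne f (e j) ⊗ₜ y j) z‖ ≤ ‖z‖) z (isClosed_le (by fun_prop) (by fun_prop))
    fun t => ?_
  obtain ⟨ξ, rfl⟩ : ∃ ξ : L, t = ξ ⊗ₜ 1 := by
    refine ⟨TensorProduct.rid ℂ L t, ?_⟩
    rw [← TensorProduct.rid_symm_apply, LinearEquiv.symm_apply_apply]
  rw [concreteMap_columnEmbedding, ← sq_le_sq₀ (norm_nonneg _) (norm_nonneg _),
    norm_sum_incl_tmul_sq hy, LinearIsometry.norm_map, TensorProduct.norm_tmul, norm_one, mul_one]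
  simp only [coe_compactRankOne, rankOne_apply, norm_smul, hf, mul_one]
  exact he.sum_inner_products_le ξ

/-- The matrix units of a column form an element of norm at most one of the amplification of a row
space. -/
theorem rowNorm_rankOne_le {n : ℕ} {y : Fin n → H} (hy : Orthonormal ℂ y) {e : Fin n → L}
    (he : Orthonormal ℂ e) {f : L} (hf : ‖f‖ = 1) :
    rowNorm L H (∑ j, compactRankOne (e j) f ⊗ₜ y j) ≤ 1 := by
  refine ContinuousLinearMap.opNorm_le_bound _ zero_le_one fun z => ?_
  rw [one_mul]
  refine HilbertTensor.induction_on (p := fun z => ‖concreteMap (rowEmbedding H)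
    (∑ j, compactRankOne (e j) f ⊗ₜ y j) z‖ ≤ ‖z‖) z (isClosed_le (by fun_prop) (by fun_prop))
    fun t => ?_
  -- The image of `t` has the coordinates of `t` along the orthonormal vectors `f ⊗ ȳⱼ`, so that the
  -- bound is Bessel's inequality.
  have key : concreteMap (rowEmbedding H) (∑ j, compactRankOne (e j) f ⊗ₜ y j)
      (incl L (ConjSpace H) t) =
        incl L ℂ ((∑ j, ⟪f ⊗ₜ[ℂ] ConjSpace.mk (y j), t⟫_ℂ • e j) ⊗ₜ 1) := by
    induction t using TensorProduct.induction_on with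
    | zero => simp
    | add t t' ht ht' =>
      simp only [map_add, ht, ht', inner_add_right, add_smul, Finset.sum_add_distrib,
        TensorProduct.add_tmul]
    | tmul ξ h =>
      rw [concreteMap_rowEmbedding, TensorProduct.sum_tmul, map_sum]
      refine Finset.sum_congr rfl fun j _ => congrArg _ ?_
      have h1 : ⟪h.val, y j⟫_ℂ = ⟪h.val, y j⟫_ℂ • (1 : ℂ) := (mul_one _).symm
      rw [TensorProduct.inner_tmul, coe_compactRankOne, rankOne_apply, h1, TensorProduct.tmul_smul,
        TensorProduct.smul_tmul', smul_smul, mul_comm]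
      rfl
  have ho : Orthonormal ℂ fun j => f ⊗ₜ[ℂ] ConjSpace.mk (y j) := by
    refine ⟨fun j => ?_, fun i j h => ?_⟩
    · rw [TensorProduct.norm_tmul, hf, (orthonormal_conjSpace hy).1 j, mul_one]
    · change ⟪f ⊗ₜ[ℂ] ConjSpace.mk (y i), f ⊗ₜ[ℂ] ConjSpace.mk (y j)⟫_ℂ = 0
      rw [TensorProduct.inner_tmul, (orthonormal_conjSpace hy).2 h, mul_zero]
  rw [key, LinearIsometry.norm_map, LinearIsometry.norm_map, TensorProduct.norm_tmul, norm_one,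
    mul_one, ← sq_le_sq₀ (norm_nonneg _) (norm_nonneg _)]
  have hsq : ‖∑ j, ⟪f ⊗ₜ[ℂ] ConjSpace.mk (y j), t⟫_ℂ • e j‖ ^ 2 =
      ∑ j, ‖⟪f ⊗ₜ[ℂ] ConjSpace.mk (y j), t⟫_ℂ‖ ^ 2 := by
    have h := he.inner_sum (fun j => ⟪f ⊗ₜ[ℂ] ConjSpace.mk (y j), t⟫_ℂ)
      (fun j => ⟪f ⊗ₜ[ℂ] ConjSpace.mk (y j), t⟫_ℂ) Finset.univ
    rw [inner_self_eq_norm_sq_to_K] at h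
    simp only [RCLike.conj_mul] at h
    exact_mod_cast h
  rw [hsq]
  exact ho.sum_inner_products_le t

/-- The operator norm of the column `∑ ι* (cⱼ · ⊗ eⱼ)` is at most the norm of `∑ cⱼ ⊗ yⱼ` in the
column Hilbertian. -/
theorem norm_sum_leg_mul_le (ι : L ≃ₗᵢ[ℂ] HilbertTensor L L) {n : ℕ} {y : Fin n → H}
    (hy : Orthonormal ℂ y) {e : Fin n → L} (he : Orthonormal ℂ e) (c : Fin n → Compacts L) :
    ‖∑ j, mulLeftCompact (leg ι (e j)) (c j)‖ ≤ columnNorm L H (∑ j, c j ⊗ₜ y j) := by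
  rw [← Submodule.norm_coe]
  refine ContinuousLinearMap.opNorm_le_bound _ (norm_nonneg _) fun x => ?_
  have h1 : ((∑ j, mulLeftCompact (leg ι (e j)) (c j) : Compacts L) : L →L[ℂ] L) x =
      ι.symm (∑ j, incl L L ((c j : L →L[ℂ] L) x ⊗ₜ e j)) := by
    rw [Submodule.coe_sum, sum_apply, map_sum]
    rfl
  rw [h1, LinearIsometryEquiv.norm_map, norm_sum_incl_tmul_eq he hy, ← concreteMap_columnEmbedding]
  refine (ContinuousLinearMap.le_opNorm _ _).trans_eq ?_
  rw [LinearIsometry.norm_map, TensorProduct.norm_tmul, norm_one, mul_one]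
  rfl

variable [CompleteSpace L]

/-- The operator norm of the row assembled from the operators `cⱼ` is at most the norm of
`∑ cⱼ ⊗ yⱼ` in the row Hilbertian. -/
theorem norm_sum_mul_star_leg_le (ι : L ≃ₗᵢ[ℂ] HilbertTensor L L) {n : ℕ} {y : Fin n → H}
    (hy : Orthonormal ℂ y) {e : Fin n → L} (he : Orthonormal ℂ e) (c : Fin n → Compacts L) :
    ‖∑ j, mulRightCompact (star (leg ι (e j))) (c j)‖ ≤ rowNorm L H (∑ j, c j ⊗ₜ y j) := by
  rw [← Submodule.norm_coe]
  refine ContinuousLinearMap.opNorm_le_bound _ (norm_nonneg _) fun x => ?_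
  -- The row is tested on `z = ∑ ξⱼ ⊗ ȳⱼ`, where the `ξⱼ` are the components of `x` along the `eⱼ`.
  set ξ : Fin n → L := fun j => star (leg ι (e j)) x
  set z := ∑ j, incl L (ConjSpace H) (ξ j ⊗ₜ ConjSpace.mk (y j))
  have hz : ‖z‖ ≤ ‖x‖ := by
    have hproj := (isStarProjection_sum_legProj ι he Finset.univ).norm_le
    have h1 : (∑ j, legProj ι (e j)) x = ι.symm (∑ j, incl L L (ξ j ⊗ₜ e j)) := by
      rw [sum_apply, map_sum]
      rfl
    rw [norm_sum_incl_tmul_eq (orthonormal_conjSpace hy) he, ← ι.symm.norm_map, ← h1]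
    simpa using ContinuousLinearMap.le_of_opNorm_le _ hproj x
  have h2 : concreteMap (rowEmbedding H) (∑ j, c j ⊗ₜ y j) z =
      incl L ℂ (((∑ j, mulRightCompact (star (leg ι (e j))) (c j) : Compacts L) : L →L[ℂ] L) x ⊗ₜ
        1) := by
    rw [map_sum (concreteMap _ _), Submodule.coe_sum, sum_apply, TensorProduct.sum_tmul,
      map_sum (incl L ℂ)]
    refine Finset.sum_congr rfl fun j _ => ?_
    rw [concreteMap_rowEmbedding, Finset.sum_eq_single j]
    · rw [inner_self_eq_norm_sq_to_K, hy.1 j]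
      simp [coe_mulRightCompact, ξ]
    · intro i _ hij
      rw [hy.2 hij.symm, TensorProduct.tmul_zero, map_zero]
    · simp
  calc _ = ‖concreteMap (rowEmbedding H) (∑ j, c j ⊗ₜ y j) z‖ := by
        rw [h2, LinearIsometry.norm_map, TensorProduct.norm_tmul, norm_one, mul_one]
    _ ≤ rowNorm L H (∑ j, c j ⊗ₜ y j) * ‖z‖ := ContinuousLinearMap.le_opNorm _ _
    _ ≤ _ := mul_le_mul_of_nonneg_left hz (norm_nonneg _)

end ColumnRow

/-! ### Comparison of the Haagerup and the four-named norms -/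

section Comparison

open InnerProductSpace

variable {L : Type*} [NormedAddCommGroup L] [InnerProductSpace ℂ L]
  {H : Type*} [NormedAddCommGroup H] [InnerProductSpace ℂ H]
  {E F : Type*} [AddCommGroup E] [Module ℂ E] [AddCommGroup F] [Module ℂ F]

theorem ampl_id (u : Ampl L E) : ampl (LinearMap.id : E →ₗ[ℂ] E) u = u :=
  LinearMap.lTensor_id_apply _ _ u

/-- The identity operator is a completely isometric isomorphism between equal quantum norms. -/
theorem isCompletelyIsometricIso_id {ν μ : Ampl L E → ℝ} (h : ∀ u, ν u = μ u) :
    IsCompletelyIsometricIso ν μ (LinearMap.id : E →ₗ[ℂ] E) where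
  bijective := by
    rw [show ⇑(ampl (L := L) (LinearMap.id : E →ₗ[ℂ] E)) = id from funext ampl_id]
    exact Function.bijective_id
  isometric u := by rw [ampl_id, h]

theorem effros_tmul (c d : Compacts L) (x : E) (y : F) :
    effros (c ⊗ₜ x) (d ⊗ₜ y) = compactMul c d ⊗ₜ[ℂ] (x ⊗ₜ[ℂ] y) := rfl

variable [CompleteSpace L]

theorem diamondTensor_tmul (ι : L ≃ₗᵢ[ℂ] HilbertTensor L L) (c d : Compacts L) (x : E) (y : F) :
    diamondTensor ι (c ⊗ₜ x) (d ⊗ₜ y) = compactDiamond ι c d ⊗ₜ[ℂ] (x ⊗ₜ[ℂ] y) := rfl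

theorem coe_compactDiamond (ι : L ≃ₗᵢ[ℂ] HilbertTensor L L) (c d : Compacts L) :
    (compactDiamond ι c d : L →L[ℂ] L) = diamond ι c d := rfl

/-- The product `(d · w) ⊙ v` with `v = ∑ cⱼ ⊗ yⱼ` has the form `a · (w ◇ v') · b`, with `v'` the
element `∑ |f⟩⟨eⱼ| ⊗ yⱼ`. -/
theorem effros_lact_sum (ι : L ≃ₗᵢ[ℂ] HilbertTensor L L) {n : ℕ} (y : Fin n → H) {e : Fin n → L}
    (he : Orthonormal ℂ e) {f : L} (hf : ‖f‖ = 1) (c : Fin n → Compacts L) (d : Compacts L)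
    (w : Ampl L E) :
    effros (lact (d : L →L[ℂ] L) w) (∑ j, c j ⊗ₜ[ℂ] y j) =
      lact (mulRightCompact (star (leg ι f)) d : L →L[ℂ] L)
        (ract ((∑ j, mulLeftCompact (leg ι (e j)) (c j) : Compacts L) : L →L[ℂ] L)
          (diamondTensor ι w (∑ j, compactRankOne f (e j) ⊗ₜ[ℂ] y j))) := by
  induction w using TensorProduct.induction_on with
  | zero => simp [effros, diamondTensor]
  | add w w' hw hw' =>
    have h1 : ∀ (u u' : Ampl L E) (v : Ampl L H), effros (u + u') v = effros u v + effros u' v :=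
      fun u u' v => by simp [effros]
    have h2 : ∀ (u u' : Ampl L E) (v : Ampl L H), diamondTensor ι (u + u') v =
      diamondTensor ι u v + diamondTensor ι u' v := fun u u' v => by simp [diamondTensor]
    simp only [map_add, h1, h2, hw, hw']
  | tmul g x =>
    have h1 : ∀ (u : Ampl L E) (v : Fin n → Ampl L H), effros u (∑ j, v j) = ∑ j, effros u (v j) :=
      fun u v => by simp [effros]
    have h2 : ∀ (u : Ampl L E) (v : Fin n → Ampl L H), diamondTensor ι u (∑ j, v j) =
        ∑ j, diamondTensor ι u (v j) := fun u v => by simp [diamondTensor]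
    rw [h1, h2, map_sum, map_sum]
    refine Finset.sum_congr rfl fun j _ => ?_
    rw [lact_tmul, effros_tmul, diamondTensor_tmul, ract_tmul, lact_tmul]
    refine congrArg (· ⊗ₜ[ℂ] (x ⊗ₜ[ℂ] y j)) (Subtype.ext ?_)
    have hb : star (leg ι (e j)) *
        ((∑ i, mulLeftCompact (leg ι (e i)) (c i) : Compacts L) : L →L[ℂ] L) = c j := by
      rw [Submodule.coe_sum, Finset.mul_sum, Finset.sum_eq_single j]
      · rw [coe_mulLeftCompact, ← mul_assoc, star_leg_mul_leg_self ι he, one_mul]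
      · intro i _ hij
        rw [coe_mulLeftCompact, ← mul_assoc, star_leg_mul_leg_of_ne ι he j i hij.symm, zero_mul]
      · simp
    have hff : star (leg ι f) * leg ι f = 1 := by
      rw [star_leg_mul_leg, inner_self_eq_norm_sq_to_K, hf]
      simp
    rw [coe_compactMul, coe_mulLeftCompact, coe_mulLeftCompact, coe_mulRightCompact,
      coe_mulRightCompact, coe_compactDiamond, coe_compactRankOne, diamond_rankOne]
    calc (d : L →L[ℂ] L) * g * c j = d * 1 * g * c j := by rw [mul_one]
      _ = d * (star (leg ι f) * leg ι f) * g * (star (leg ι (e j)) *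
          ((∑ i, mulLeftCompact (leg ι (e i)) (c i) : Compacts L) : L →L[ℂ] L)) := by rw [hff, hb]
      _ = _ := by simp only [mul_assoc]

/-- The product `u ⊙ (w · d)` with `u = ∑ cⱼ ⊗ yⱼ` has the form `a · (u' ◇ w) · b`, with `u'` the
element `∑ |eⱼ⟩⟨f| ⊗ yⱼ`. -/
theorem effros_sum_ract (ι : L ≃ₗᵢ[ℂ] HilbertTensor L L) {n : ℕ} (y : Fin n → H) {e : Fin n → L}
    (he : Orthonormal ℂ e) {f : L} (hf : ‖f‖ = 1) (c : Fin n → Compacts L) (d : Compacts L)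
    (w : Ampl L E) :
    effros (∑ j, c j ⊗ₜ[ℂ] y j) (ract (d : L →L[ℂ] L) w) =
      lact ((∑ j, mulRightCompact (star (leg (swapped ι) (e j))) (c j) : Compacts L) : L →L[ℂ] L)
        (ract (mulLeftCompact (leg (swapped ι) f) d : L →L[ℂ] L)
          (diamondTensor ι (∑ j, compactRankOne (e j) f ⊗ₜ[ℂ] y j) w)) := by
  induction w using TensorProduct.induction_on with
  | zero => simp [effros, diamondTensor]
  | add w w' hw hw' =>
    have h1 : ∀ (u : Ampl L H) (v v' : Ampl L E), effros u (v + v') = effros u v + effros u v' :=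
      fun u v v' => by simp [effros]
    have h2 : ∀ (u : Ampl L H) (v v' : Ampl L E), diamondTensor ι u (v + v') =
      diamondTensor ι u v + diamondTensor ι u v' := fun u v v' => by simp [diamondTensor]
    simp only [map_add, h1, h2, hw, hw']
  | tmul g x =>
    have h1 : ∀ (u : Fin n → Ampl L H) (v : Ampl L E),
        effros (∑ j, u j) v = ∑ j, effros (u j) v :=
      fun u v => by simp [effros]
    have h2 : ∀ (u : Fin n → Ampl L H) (v : Ampl L E), diamondTensor ι (∑ j, u j) v =
      ∑ j, diamondTensor ι (u j) v := fun u v => by simp [diamondTensor]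
    rw [h1, h2, map_sum, map_sum]
    refine Finset.sum_congr rfl fun j _ => ?_
    rw [ract_tmul, effros_tmul, diamondTensor_tmul, ract_tmul, lact_tmul]
    refine congrArg (· ⊗ₜ[ℂ] (y j ⊗ₜ[ℂ] x)) (Subtype.ext ?_)
    have hb : ((∑ i, mulRightCompact (star (leg (swapped ι) (e i))) (c i) : Compacts L) :
        L →L[ℂ] L) * leg (swapped ι) (e j) = c j := by
      rw [Submodule.coe_sum, Finset.sum_mul, Finset.sum_eq_single j]
      · rw [coe_mulRightCompact, mul_assoc, star_leg_mul_leg_self (swapped ι) he, mul_one]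
      · intro i _ hij
        rw [coe_mulRightCompact, mul_assoc, star_leg_mul_leg_of_ne (swapped ι) he i j hij,
          mul_zero]
      · simp
    have hff : star (leg (swapped ι) f) * leg (swapped ι) f = 1 := by
      rw [star_leg_mul_leg, inner_self_eq_norm_sq_to_K, hf]
      simp
    rw [coe_compactMul, coe_mulLeftCompact, coe_mulRightCompact, coe_mulRightCompact,
      coe_mulLeftCompact, coe_compactDiamond, coe_compactRankOne, ← diamond_swapped,
      diamond_rankOne]
    calc (c j : L →L[ℂ] L) * (g * d) = c j * (g * (1 * d)) := by rw [one_mul]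
      _ = ((∑ i, mulRightCompact (star (leg (swapped ι) (e i))) (c i) : Compacts L) :
          L →L[ℂ] L) * leg (swapped ι) (e j) *
            (g * (star (leg (swapped ι) f) * leg (swapped ι) f * d)) := by rw [hff, hb]
      _ = _ := by simp only [mul_assoc]

/-- Every element `u ⊙ v` is a finite sum of elements `a · (w ◇ z) · b` such that the sum of the
products `‖a‖ ‖w‖ ‖z‖ ‖b‖` exceeds `‖u‖ ‖v‖` by as little as desired. -/
def DiamondFactorizable (ι : L ≃ₗᵢ[ℂ] HilbertTensor L L) (ν : Ampl L E → ℝ) (μ : Ampl L F → ℝ) :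
    Prop :=
  ∀ (u : Ampl L E) (v : Ampl L F) (ε : ℝ), 0 < ε →
    ∃ (n : ℕ) (a : Fin n → Compacts L) (w : Fin n → Ampl L E) (z : Fin n → Ampl L F)
      (b : Fin n → Compacts L),
      effros u v = ∑ k, lact (a k : L →L[ℂ] L) (ract (b k : L →L[ℂ] L)
        (diamondTensor ι (w k) (z k))) ∧
      ∑ k, ‖a k‖ * ν (w k) * μ (z k) * ‖b k‖ ≤ ν u * μ v + ε

/-- With `u` a sum of products `d · w`, each `(d · w) ⊙ v` is of the form required by
`effros_lact_sum`, whose coefficients have norms at most `‖d‖`, `1` and `‖v‖`. -/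
theorem diamondFactorizable_column (hL : ¬ FiniteDimensional ℂ L)
    (ι : L ≃ₗᵢ[ℂ] HilbertTensor L L) {ν : Ampl L E → ℝ} (hν : IsQuantumNorm ν) :
    DiamondFactorizable ι ν (columnNorm L H) := by
  intro u v ε hε
  have hμ := columnNorm_isQuantumNorm (L := L) (H := H)
  have hμv := hμ.nonneg v
  -- The error is later multiplied by the norm of `v`, which may be zero.
  obtain ⟨m, d, w, hu, hcost⟩ := hν.exists_sum_lact_le hL ι u
    (ε := ε / (columnNorm L H v + 1)) (by positivity)
  obtain ⟨n, y, c, hy, rfl⟩ := exists_sum_tmul_orthonormal v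
  obtain ⟨e, he⟩ := exists_orthonormal_nat hL
  have he' : Orthonormal ℂ fun j : Fin n => e j := he.comp _ Fin.val_injective
  refine ⟨m, fun k => mulRightCompact (star (leg ι (e 0))) (d k), w,
    fun _ => ∑ j : Fin n, compactRankOne (e 0) (e j) ⊗ₜ y j,
    fun _ => ∑ j : Fin n, mulLeftCompact (leg ι (e j)) (c j), ?_, ?_⟩
  · have h1 : ∀ (u : Fin m → Ampl L E) (v : Ampl L H), effros (∑ j, u j) v = ∑ j, effros (u j) v :=
      fun u v => by simp [effros]
    rw [hu, h1]
    exact Finset.sum_congr rfl fun k _ => effros_lact_sum ι y he' (he.1 0) c (d k) (w k)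
  · set M := columnNorm L H (∑ j, c j ⊗ₜ y j)
    have hterm : ∀ k, ‖mulRightCompact (star (leg ι (e 0))) (d k)‖ * ν (w k) *
        columnNorm L H (∑ j : Fin n, compactRankOne (e 0) (e j) ⊗ₜ y j) *
          ‖∑ j : Fin n, mulLeftCompact (leg ι (e j)) (c j)‖ ≤ ‖d k‖ * ν (w k) * 1 * M := fun k => by
      have h0 := hν.nonneg (w k)
      have h1 : ‖mulRightCompact (star (leg ι (e 0))) (d k)‖ ≤ ‖d k‖ :=
        (norm_mul_le (d k : L →L[ℂ] L) (star (leg ι (e 0)))).trans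
          (mul_le_of_le_one_right (norm_nonneg _) (by
            rw [norm_star]
            exact norm_leg ι (he.1 0)))
      have h2 := columnNorm_rankOne_le hy he' (he.1 0)
      have h3 := norm_sum_leg_mul_le ι hy he' c
      have h4 := hμ.nonneg (∑ j : Fin n, compactRankOne (e 0) (e j) ⊗ₜ y j)
      gcongr
    calc _ ≤ ∑ k, ‖d k‖ * ν (w k) * 1 * M := Finset.sum_le_sum fun k _ => hterm k
      _ = (∑ k, ‖d k‖ * ν (w k)) * M := by simp only [mul_one, Finset.sum_mul]
      _ ≤ (ν u + ε / (M + 1)) * M := mul_le_mul_of_nonneg_right hcost hμv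
      _ = ν u * M + ε * (M / (M + 1)) := by ring
      _ ≤ ν u * M + ε * 1 := by
          gcongr
          rw [div_le_one (by positivity)]
          linarith
      _ = _ := by rw [mul_one]

/-- The mirror image of `diamondFactorizable_column`, by `effros_sum_ract`. -/
theorem diamondFactorizable_row (hL : ¬ FiniteDimensional ℂ L)
    (ι : L ≃ₗᵢ[ℂ] HilbertTensor L L) {ν : Ampl L E → ℝ} (hν : IsQuantumNorm ν) :
    DiamondFactorizable ι (rowNorm L H) ν := by
  intro v u ε hε
  have hμ := rowNorm_isQuantumNorm (L := L) (H := H)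
  have hμv := hμ.nonneg v
  -- The error is later multiplied by the norm of `v`, which may be zero.
  obtain ⟨m, d, w, hu, hcost⟩ := hν.exists_sum_ract_le hL ι u
    (ε := ε / (rowNorm L H v + 1)) (by positivity)
  obtain ⟨n, y, c, hy, rfl⟩ := exists_sum_tmul_orthonormal v
  obtain ⟨e, he⟩ := exists_orthonormal_nat hL
  have he' : Orthonormal ℂ fun j : Fin n => e j := he.comp _ Fin.val_injective
  refine ⟨m, fun _ => ∑ j : Fin n, mulRightCompact (star (leg (swapped ι) (e j))) (c j),
    fun _ => ∑ j : Fin n, compactRankOne (e j) (e 0) ⊗ₜ y j, w,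
    fun k => mulLeftCompact (leg (swapped ι) (e 0)) (d k), ?_, ?_⟩
  · have h1 : ∀ (v : Ampl L H) (u : Fin m → Ampl L E), effros v (∑ j, u j) = ∑ j, effros v (u j) :=
      fun v u => by simp [effros]
    rw [hu, h1]
    exact Finset.sum_congr rfl fun k _ => effros_sum_ract ι y he' (he.1 0) c (d k) (w k)
  · set M := rowNorm L H (∑ j, c j ⊗ₜ y j)
    have hterm : ∀ k, ‖∑ j : Fin n, mulRightCompact (star (leg (swapped ι) (e j))) (c j)‖ *
        rowNorm L H (∑ j : Fin n, compactRankOne (e j) (e 0) ⊗ₜ y j) * ν (w k) *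
          ‖mulLeftCompact (leg (swapped ι) (e 0)) (d k)‖ ≤ M * 1 * ν (w k) * ‖d k‖ := fun k => by
      have h0 := hν.nonneg (w k)
      have h1 : ‖mulLeftCompact (leg (swapped ι) (e 0)) (d k)‖ ≤ ‖d k‖ :=
        (norm_mul_le (leg (swapped ι) (e 0)) (d k : L →L[ℂ] L)).trans
          (mul_le_of_le_one_left (norm_nonneg _) (norm_leg (swapped ι) (he.1 0)))
      have h2 := rowNorm_rankOne_le hy he' (he.1 0)
      have h3 := norm_sum_mul_star_leg_le (swapped ι) hy he' c
      have h4 := hμ.nonneg (∑ j : Fin n, compactRankOne (e j) (e 0) ⊗ₜ y j)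
      gcongr
    calc _ ≤ ∑ k, M * 1 * ν (w k) * ‖d k‖ := Finset.sum_le_sum fun k _ => hterm k
      _ = M * (∑ k, ‖d k‖ * ν (w k)) := by
          rw [Finset.mul_sum]
          exact Finset.sum_congr rfl fun k _ => by ring
      _ ≤ M * (ν u + ε / (M + 1)) := mul_le_mul_of_nonneg_left hcost hμv
      _ = M * ν u + ε * (M / (M + 1)) := by ring
      _ ≤ M * ν u + ε * 1 := by
          gcongr
          rw [div_le_one (by positivity)]
          linarith
      _ = _ := by rw [mul_one]

/-- Two sets of nonnegative numbers have the same infimum if each of them has elements below, or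
nearly below, every element of the other one. -/
theorem sInf_eq_of_forall_exists_le {A B : Set ℝ} (hA : ∀ r ∈ A, 0 ≤ r) (hB : ∀ r ∈ B, 0 ≤ r)
    (hAB : ∀ r ∈ A, ∃ s ∈ B, s ≤ r) (hBA : ∀ r ∈ B, ∀ ε > 0, ∃ s ∈ A, s ≤ r + ε) :
    sInf A = sInf B := by
  rcases A.eq_empty_or_nonempty with rfl | hne
  -- If both sets are empty, both infima have the same default value.
  · have : B = ∅ := Set.eq_empty_of_forall_notMem fun r hr => by
      obtain ⟨s, hs, -⟩ := hBA r hr 1 one_pos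
      exact hs
    rw [this]
  · have hneB : B.Nonempty := by
      obtain ⟨r, hr⟩ := hne
      obtain ⟨s, hs, -⟩ := hAB r hr
      exact ⟨s, hs⟩
    refine le_antisymm (le_csInf hneB fun r hr => le_of_forall_pos_le_add fun ε hε => ?_)
      (le_csInf hne fun r hr => ?_)
    · obtain ⟨s, hs, h⟩ := hBA r hr ε hε
      exact (csInf_le ⟨0, hA⟩ hs).trans h
    · obtain ⟨s, hs, h⟩ := hAB r hr
      exact (csInf_le ⟨0, hB⟩ hs).trans h

/-- The inequality `‖·‖_h ≤ ‖·‖_4` holds for all quantum spaces; the factorization property gives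
the converse. -/
theorem fourNorm_eq_haagerupNorm (hL : ¬ FiniteDimensional ℂ L) (ι : L ≃ₗᵢ[ℂ] HilbertTensor L L)
    {ν : Ampl L E → ℝ} {μ : Ampl L F → ℝ} (hν : IsQuantumNorm ν) (hμ : IsQuantumNorm μ)
    (h : DiamondFactorizable ι ν μ) (U : Ampl L (E ⊗[ℂ] F)) :
    fourNorm ι ν μ U = haagerupNorm ν μ U := by
  refine sInf_eq_of_forall_exists_le ?_ ?_ ?_ ?_
  · rintro _ ⟨n, a, u, v, b, -, rfl⟩
    exact Finset.sum_nonneg fun k _ => mul_nonneg (mul_nonneg (mul_nonneg (norm_nonneg _)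
      (hν.nonneg _)) (hμ.nonneg _)) (norm_nonneg _)
  · rintro _ ⟨n, u, v, -, rfl⟩
    exact Finset.sum_nonneg fun k _ => mul_nonneg (hν.nonneg _) (hμ.nonneg _)
  · rintro _ ⟨n, a, u, v, b, rfl, rfl⟩
    refine ⟨_, ⟨n, fun k => lactDiamondOne ι (a k) (u k),
      fun k => ractDiamondOne (swapped ι) (b k) (v k),
      Finset.sum_congr rfl fun k _ => lact_ract_diamondTensor ι _ _ _ _, rfl⟩,
      Finset.sum_le_sum fun k _ => ?_⟩
    calc _ ≤ (‖a k‖ * ν (u k)) * (‖b k‖ * μ (v k)) :=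
          mul_le_mul (hν.lactDiamondOne_le hL ι _ _) (hμ.ractDiamondOne_le hL (swapped ι) _ _)
            (hμ.nonneg _) (mul_nonneg (norm_nonneg _) (hν.nonneg _))
      _ = _ := by ring
  · rintro _ ⟨n, u, v, rfl, rfl⟩ ε hε
    choose m a w z b heq hle using fun k => h (u k) (v k) (ε / (n + 1)) (by positivity)
    let φ := (finSigmaFinEquiv (m := n) (n := m)).symm
    refine ⟨_, ⟨_, fun i => a (φ i).1 (φ i).2, fun i => w (φ i).1 (φ i).2,
      fun i => z (φ i).1 (φ i).2, fun i => b (φ i).1 (φ i).2, ?_, rfl⟩, ?_⟩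
    · rw [φ.sum_comp fun p => lact (a p.1 p.2 : L →L[ℂ] L) (ract (b p.1 p.2 : L →L[ℂ] L)
        (diamondTensor ι (w p.1 p.2) (z p.1 p.2))), Fintype.sum_sigma]
      exact Finset.sum_congr rfl fun k _ => heq k
    · rw [φ.sum_comp fun p => ‖a p.1 p.2‖ * ν (w p.1 p.2) * μ (z p.1 p.2) * ‖b p.1 p.2‖,
        Fintype.sum_sigma]
      calc _ ≤ ∑ k, (ν (u k) * μ (v k) + ε / (n + 1)) := Finset.sum_le_sum fun k _ => hle k
        _ = ∑ k, ν (u k) * μ (v k) + ε * (n / (n + 1)) := by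
            rw [Finset.sum_add_distrib, Finset.sum_const, Finset.card_univ, Fintype.card_fin,
              nsmul_eq_mul]
            ring
        _ ≤ ∑ k, ν (u k) * μ (v k) + ε * 1 := by
            gcongr
            rw [div_le_one (by positivity)]
            linarith
        _ = _ := by rw [mul_one]

end Comparison

/-- For every quantum space `E` and every Hilbert space `H`, the identity operators
`E ⊗_4 H_c → E ⊗_h H_c` and `H_r ⊗_4 E → H_r ⊗_h E` are completely isometric isomorphisms. -/
theorem proposition28
    {L : Type*} [NormedAddCommGroup L] [InnerProductSpace ℂ L] [CompleteSpace L]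
    [TopologicalSpace.SeparableSpace L] (hL : ¬ FiniteDimensional ℂ L)
    (ι : L ≃ₗᵢ[ℂ] HilbertTensor L L)
    {E : Type*} [AddCommGroup E] [Module ℂ E] (ν : Ampl L E → ℝ) (hν : IsQuantumNorm ν)
    {H : Type*} [NormedAddCommGroup H] [InnerProductSpace ℂ H] [CompleteSpace H] :
    IsCompletelyIsometricIso (fourNorm ι ν (columnNorm L H)) (haagerupNorm ν (columnNorm L H))
        (LinearMap.id : E ⊗[ℂ] H →ₗ[ℂ] E ⊗[ℂ] H) ∧
      IsCompletelyIsometricIso (fourNorm ι (rowNorm L H) ν) (haagerupNorm (rowNorm L H) ν)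
        (LinearMap.id : H ⊗[ℂ] E →ₗ[ℂ] H ⊗[ℂ] E) := by
  have hc := columnNorm_isQuantumNorm (L := L) (H := H)
  have hr := rowNorm_isQuantumNorm (L := L) (H := H)
  exact ⟨isCompletelyIsometricIso_id
      (fourNorm_eq_haagerupNorm hL ι hν hc (diamondFactorizable_column hL ι hν)),
    isCompletelyIsometricIso_id
      (fourNorm_eq_haagerupNorm hL ι hr hν (diamondFactorizable_row hL ι hν))⟩
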